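/- Let $\alpha\neq 1$ be an integer, let $$G(\alpha)=\langle A,B \mid A^{[A,B]}=A^{\alpha},\ B^{[B,A]}=B^{\alpha}\rangle$$ be the Macdonald group, where $[a,b]=a^{-1}b^{-1}ab$ and $a^b=b^{-1}ab$, let $p$ be a prime factor of $\alpha-1$, let $m=v_p(\alpha-1)$, and let $J$ be the Sylow $p$-subgroup of $G(\alpha)$. For a group $T$ and a positive integer $n$, write $T^n$ for the subgroup generated by all $t^n$ with $t\in T$, write $Z(T)$ for the center of $T$, and write $Z_i(T)$ for the $i$-th term of the upper central series of $T$ (so $Z_0(T)=1$, $Z_1(T)=Z(T)$). For a commutative ring $R$, let $\mathrm{Heis}(R)$ be the group of upper unitriangular $3\times 3$ matrices over $R$. Suppose that either $p>3$, or else $p=3$ and ($m>1$ or $(\alpha-1)/3\equiv 1 \pmod 3$). Then: 1. $Z(J)=J^{p^{2m}}$. 2. $Z_3(J)=J^{p^{m}}$, and this group is abelian of order $p^{4m}$ with presentation $$\langle X,Y,Z \mid XY=YX,\ YZ=ZY,\ XZ=ZX,\ X^{p^{2m}}=1,\ X^{p^m}Y^{p^m}=1,\ Z^{p^m}=1\rangle.$$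 3. $J/Z_3(J)\cong \mathrm{Heis}(\mathbb{Z}/p^m\mathbb{Z})$. 4. $J$ has exponent $p^{3m}$. -/

import Mathlib

/-- The commutator in the convention `[a, b] = a⁻¹ b⁻¹ a b`
(Mathlib's `⁅a, b⁆` is `a b a⁻¹ b⁻¹`). -/
def commR {T : Type*} [Group T] (a b : T) : T := a⁻¹ * b⁻¹ * a * b

/-- Right conjugation `a ^ b = b⁻¹ a b`. -/
def conjBy {T : Type*} [Group T] (a b : T) : T := b⁻¹ * a * b

/-- The relators of the Macdonald group `G(α)`, on the free generators `A = of 0`, `B = of 1`: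
`A^[A,B] = A^α` and `B^[B,A] = B^α`. -/
def macdonaldRels (α : ℤ) : Set (FreeGroup (Fin 2)) :=
  let A : FreeGroup (Fin 2) := FreeGroup.of 0
  let B : FreeGroup (Fin 2) := FreeGroup.of 1
  {conjBy A (commR A B) * (A ^ α)⁻¹, conjBy B (commR B A) * (B ^ α)⁻¹}

/-- The Macdonald group `G(α) = ⟨A, B | A^[A,B] = A^α, B^[B,A] = B^α⟩`. -/
abbrev MacdonaldGroup (α : ℤ) : Type := PresentedGroup (macdonaldRels α)

/-- `T^n`: the subgroup of `T` generated by all `t ^ n` with `t ∈ T`. -/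
def powSubgroup (T : Type*) [Group T] (n : ℕ) : Subgroup T :=
  Subgroup.closure (Set.range fun t : T => t ^ n)

/-- The Heisenberg group over `R`: the upper unitriangular `3 × 3` matrices over `R`,
as a subgroup of `SL₃(R)`. -/
def Heis (R : Type*) [CommRing R] : Subgroup (Matrix.SpecialLinearGroup (Fin 3) R) where
  carrier := {M | (∀ i, M.1 i i = 1) ∧ ∀ i j, j < i → M.1 i j = 0}
  one_mem' := by
    refine ⟨fun i => by simp, fun i j h => ?_⟩
    simp [h.ne']
  mul_mem' := by
    rintro M N ⟨hM, hM'⟩ ⟨hN, hN'⟩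
    have a1 := hM' 1 0 (by decide)
    have a2 := hM' 2 0 (by decide)
    have a3 := hM' 2 1 (by decide)
    have b1 := hN' 1 0 (by decide)
    have b2 := hN' 2 0 (by decide)
    have b3 := hN' 2 1 (by decide)
    refine ⟨fun i => ?_, fun i j h => ?_⟩
    · fin_cases i <;>
        simp [Matrix.mul_apply, Fin.sum_univ_three, hM, hN, a1, a2, a3, b1, b2, b3]
    · fin_cases i <;> fin_cases j <;>
        simp [Matrix.mul_apply, Fin.sum_univ_three, a1, a2, a3, b1, b2, b3] at h ⊢
  inv_mem' := by
    rintro M ⟨hM, hM'⟩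
    have a1 := hM' 1 0 (by decide)
    have a2 := hM' 2 0 (by decide)
    have a3 := hM' 2 1 (by decide)
    refine ⟨fun i => ?_, fun i j h => ?_⟩
    · fin_cases i <;>
        simp [Matrix.SpecialLinearGroup.coe_inv, Matrix.adjugate_fin_three, hM, a1, a2, a3]
    · fin_cases i <;> fin_cases j <;>
        simp [Matrix.SpecialLinearGroup.coe_inv, Matrix.adjugate_fin_three, a1, a2, a3] at h ⊢

/-- Case 1 for a prime factor `p` of `α - 1`, with `m = v_p(α - 1)`: either `p > 3`, or else
`p = 3` and (`m > 1` or `(α - 1) / 3 ≡ 1 mod 3`); the division is exact when `3 ∣ α - 1`. -/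
def IsCaseOne (p : ℕ) (α : ℤ) : Prop :=
  3 < p ∨ (p = 3 ∧ (1 < padicValInt p (α - 1) ∨ (α - 1) / 3 ≡ 1 [ZMOD 3]))

/-- The relators, on the free generators `X = of 0`, `Y = of 1`, `Z = of 2`, of
`⟨X, Y, Z | XY = YX, YZ = ZY, XZ = ZX, X^(p^(2m)) = 1, X^(p^m) Y^(p^m) = 1, Z^(p^m) = 1⟩`. -/
def zThreeRels (p m : ℕ) : Set (FreeGroup (Fin 3)) :=
  let X : FreeGroup (Fin 3) := FreeGroup.of 0
  let Y : FreeGroup (Fin 3) := FreeGroup.of 1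
  let Z : FreeGroup (Fin 3) := FreeGroup.of 2
  {X * Y * (Y * X)⁻¹, Y * Z * (Z * Y)⁻¹, X * Z * (Z * X)⁻¹,
    X ^ p ^ (2 * m), X ^ p ^ m * Y ^ p ^ m, Z ^ p ^ m}

/-! Write `c = [a, b]` and `q = p ^ m`. The relations say that conjugation by `c` raises `a` to the
power `α`, and conjugation by `c⁻¹` does the same to `b`. Conjugating `c ^ k` by `a * b = b * a * c`
in two ways shows that, with `μ = α ^ k - 1` and `D = defect α μ`, a power of `b` equals `a ^ (-α
D)` (`zpow_defect_eq`). So `a ^ (α D)` is central in the group generated by `a` and `b`. Any `a ^ i`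
commuting with `b` satisfies `a ^ (i (α - 1)) = 1`, so `a` and `b` have finite order. The primes
dividing these orders divide `α - 1`, and this makes `G(α)` finite and nilpotent. Hence `J` is a
quotient of `G(α)` through which every homomorphism to a `p`-group factors.

Upper bound: for `k = 1` the case hypothesis makes the `p`-adic valuation of `D` equal to `2m`
(`exists_defect_eq`). In `J` this gives `a ^ q²` central, `a ^ q³ = 1` and `a ^ q² * b ^ q² = 1`
(`macdonaldCore`). These imply `c ^ q² = 1` and the normal form `a ^ i * b ^ j * c ^ k` for every
element.

Lower bound: the action on the cosets `a ^ i b ^ j ⟨c⟩` is written down explicitly on pairs `(i, j)`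
modulo `p ^ (3m)`, divided by a diagonal subgroup that reflects `a ^ q² * b ^ q² = 1`. There `a`
translates the first coordinate, `c` scales both, and `b⁻¹` acts by polynomials interpolating
geometric sums and powers of `α`. This `p`-group quotient shows that the normal forms have no
further coincidences (`exists_macdonald_model`). A second quotient is the Heisenberg group over
`ZMod q`.

With both bounds, commutators of a normal form with `a` and `b` give `Z_1 = ⟨a ^ q²⟩`, `Z_2 = ⟨a ^
q², c ^ q⟩` and `Z_3 = ⟨a ^ q, b ^ q, c ^ q⟩`, the last being the kernel of the map to the
Heisenberg group. All `q`-th powers lie in `Z_3` because that quotient has exponent `q`, and `q`-th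
powers of elements of `Z_3` lie in `Z_1`. -/

/-! ### Consequences of the Macdonald relations in an arbitrary group. -/

/-- A pair of elements satisfying the defining relations of the Macdonald group. -/
structure IsMacdonaldPair {T : Type*} [Group T] (α : ℤ) (a b : T) : Prop where
  conj_left : conjBy a (commR a b) = a ^ α
  conj_right : conjBy b (commR b a) = b ^ α

/-- The geometric sum `1 + α + ⋯ + α ^ (k - 1)`. -/
def geomSum (α : ℤ) (k : ℕ) : ℤ := ∑ i ∈ Finset.range k, α ^ i

theorem geomSum_succ (α : ℤ) (k : ℕ) : geomSum α (k + 1) = geomSum α k + α ^ k :=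
  Finset.sum_range_succ _ _

theorem geomSum_mul (α : ℤ) (k : ℕ) : geomSum α k * (α - 1) = α ^ k - 1 :=
  geom_sum_mul α k

theorem commR_swap {T : Type*} [Group T] (a b : T) : commR b a = (commR a b)⁻¹ := by
  simp [commR, mul_assoc]

theorem map_commR {T U : Type*} [Group T] [Group U] (f : T →* U) (a b : T) :
    f (commR a b) = commR (f a) (f b) := by
  simp [commR]

theorem map_conjBy {T U : Type*} [Group T] [Group U] (f : T →* U) (a b : T) :
    f (conjBy a b) = conjBy (f a) (f b) := by
  simp [conjBy]

theorem mul_eq_mul_mul_commR {T : Type*} [Group T] (a b : T) : a * b = b * a * commR a b := by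
  simp [commR, mul_assoc]

namespace IsMacdonaldPair

variable {T : Type*} [Group T] {α : ℤ} {a b : T}

theorem swap (h : IsMacdonaldPair α a b) : IsMacdonaldPair α b a :=
  ⟨h.conj_right, h.conj_left⟩

theorem map {U : Type*} [Group U] (h : IsMacdonaldPair α a b) (f : T →* U) :
    IsMacdonaldPair α (f a) (f b) := by
  constructor
  · rw [← map_commR, ← map_conjBy, h.conj_left, map_zpow]
  · rw [← map_commR, ← map_conjBy, h.conj_right, map_zpow]

theorem change_exponent (h : IsMacdonaldPair α a b) {β : ℤ} (ha : a ^ β = a ^ α)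
    (hb : b ^ β = b ^ α) : IsMacdonaldPair β a b :=
  ⟨h.conj_left.trans ha.symm, h.conj_right.trans hb.symm⟩

theorem inv_mul_mul (h : IsMacdonaldPair α a b) :
    (commR a b)⁻¹ * a * commR a b = a ^ α := h.conj_left

theorem zpow_mul_commR (h : IsMacdonaldPair α a b) (i : ℤ) :
    a ^ i * commR a b = commR a b * a ^ (i * α) := by
  have h1 : ((commR a b)⁻¹ * a * commR a b) ^ i = (a ^ α) ^ i := by rw [h.inv_mul_mul]
  have h2 := conj_zpow (a := (commR a b)⁻¹) (b := a) (i := i)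
  rw [inv_inv, h1, ← zpow_mul, mul_comm α i] at h2
  rw [h2]
  group

/-- Moving `c ^ k` leftwards past a power of `a`. -/
theorem zpow_mul_commR_pow (h : IsMacdonaldPair α a b) (i : ℤ) (k : ℕ) :
    a ^ i * commR a b ^ k = commR a b ^ k * a ^ (i * α ^ k) := by
  induction k generalizing i with
  | zero => simp
  | succ k ih =>
    rw [pow_succ, ← mul_assoc, ih, mul_assoc, h.zpow_mul_commR, ← mul_assoc, pow_succ, ← mul_assoc]

/-- Moving `c ^ k` rightwards past a power of `b`. -/
theorem commR_pow_mul_zpow (h : IsMacdonaldPair α a b) (i : ℤ) (k : ℕ) :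
    commR a b ^ k * b ^ i = b ^ (i * α ^ k) * commR a b ^ k := by
  have h1 := h.swap.zpow_mul_commR_pow i k
  rw [commR_swap, inv_pow] at h1
  rw [eq_comm, ← eq_inv_mul_iff_mul_eq.trans eq_comm]
  rw [← mul_inv_eq_iff_eq_mul] at h1
  rw [← h1]
  group

theorem conj_zpow_left (a b : T) (i : ℤ) : b⁻¹ * a ^ i * b = (a * commR a b) ^ i := by
  have h2 := conj_zpow (a := b⁻¹) (b := a) (i := i)
  rw [inv_inv] at h2
  rw [← h2]
  simp [commR, mul_assoc]

theorem mul_commR_pow (h : IsMacdonaldPair α a b) (k : ℕ) :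
    (a * commR a b) ^ k = commR a b ^ k * a ^ (α * geomSum α k) := by
  induction k with
  | zero => simp [geomSum]
  | succ k ih =>
    have h1 := h.zpow_mul_commR (α * geomSum α k + 1)
    rw [pow_succ, ih, pow_succ, mul_assoc, ← mul_assoc (a ^ _) a, ← zpow_add_one, h1, ← mul_assoc]
    congr 2
    have := geomSum_mul α k
    rw [geomSum_succ]
    linear_combination α * this

/-- The conjugate of `a ^ k` by `b`. -/
theorem conj_pow (h : IsMacdonaldPair α a b) (k : ℕ) :
    b⁻¹ * a ^ k * b = commR a b ^ k * a ^ (α * geomSum α k) := by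
  rw [← h.mul_commR_pow, ← zpow_natCast, conj_zpow_left, zpow_natCast]

theorem inv_commR_mul_pow (h : IsMacdonaldPair α a b) (k : ℕ) :
    ((commR a b)⁻¹ * b) ^ k = (commR a b ^ k)⁻¹ * b ^ (geomSum α k) := by
  induction k with
  | zero => simp [geomSum]
  | succ k ih =>
    have h1 := h.swap.zpow_mul_commR (geomSum α k)
    rw [commR_swap] at h1
    rw [pow_succ, ih, pow_succ', mul_inv_rev, mul_assoc, ← mul_assoc (b ^ _), h1, mul_assoc,
      ← zpow_add_one, mul_assoc]
    congr 3
    rw [add_comm, geomSum, geomSum, Finset.sum_range_succ', Finset.sum_mul]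
    simp [pow_succ, add_comm]

theorem conj_commR_pow_left (h : IsMacdonaldPair α a b) (k : ℕ) :
    a⁻¹ * commR a b ^ k * a = commR a b ^ k * a ^ (1 - α ^ k) := by
  have h1 := h.zpow_mul_commR_pow (-1) k
  rw [zpow_neg_one] at h1
  rw [h1, mul_assoc, ← zpow_add_one]
  congr 2
  ring

theorem conj_commR_pow_right (h : IsMacdonaldPair α a b) (k : ℕ) :
    b⁻¹ * commR a b ^ k * b = b ^ (α ^ k - 1) * commR a b ^ k := by
  have h1 := h.commR_pow_mul_zpow 1 k
  rw [zpow_one] at h1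
  rw [mul_assoc, h1, ← mul_assoc, ← zpow_neg_one, ← zpow_add]
  congr 2
  ring

/-- The exponent `∑_{i < μ} (α ^ μ - α ^ i)`. -/
def defect (α : ℤ) (μ : ℕ) : ℤ := μ * α ^ μ - geomSum α μ

/-- Since `a * b = b * a * c`, conjugating `c ^ k` by `a` then `b` agrees with conjugating it by
`b`, then `a`, then `c`. Comparing the two values and moving powers of `c` to one side leaves the
difference between `μ * α ^ μ` and the geometric sum, which is `defect`. -/
theorem zpow_defect_mul_commR_pow (h : IsMacdonaldPair α a b) {k μ : ℕ} (hμ : (μ : ℤ) = α ^ k - 1) :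
    b ^ defect α μ * commR a b ^ (μ + k) = commR a b ^ (μ + k) * a ^ (-(α * defect α μ)) := by
  set c := commR a b with hc
  have e1 : b⁻¹ * (a⁻¹ * c ^ k * a) * b = b ^ (μ : ℤ) * c ^ k * (a ^ (-(α * geomSum α μ)) * (c ^ μ)⁻¹) := by
    rw [h.conj_commR_pow_left, show 1 - α ^ k = -(μ : ℤ) by rw [hμ]; ring]
    calc b⁻¹ * (c ^ k * a ^ (-(μ : ℤ))) * b
        = (b⁻¹ * c ^ k * b) * (b⁻¹ * a ^ μ * b)⁻¹ := by
          rw [zpow_neg, zpow_natCast]; group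
      _ = _ := by
          rw [h.conj_commR_pow_right, h.conj_pow, mul_inv_rev, ← zpow_neg, hμ]
  have e2 : c⁻¹ * (a⁻¹ * (b⁻¹ * c ^ k * b) * a) * c =
      (c ^ μ)⁻¹ * b ^ geomSum α μ * (c ^ k * a ^ (-(α * μ))) := by
    rw [h.conj_commR_pow_right, ← hμ]
    calc c⁻¹ * (a⁻¹ * (b ^ (μ : ℤ) * c ^ k) * a) * c
        = (c⁻¹ * (a⁻¹ * b ^ (μ : ℤ) * a) * c) * (c⁻¹ * ((a⁻¹ * c ^ k * a) * c)) := by group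
      _ = (c⁻¹ * b) ^ μ * (c ^ k * a ^ (-(α * μ))) := by
          congr 1
          · rw [conj_zpow_left, commR_swap, zpow_natCast]
            have := _root_.conj_pow (a := c⁻¹) (b := b * c⁻¹) (i := μ)
            rw [inv_inv] at this
            rw [← this]
            congr 1
            group
          · rw [h.conj_commR_pow_left, show 1 - α ^ k = -(μ : ℤ) by rw [hμ]; ring, mul_assoc,
              h.zpow_mul_commR, show -(μ : ℤ) * α = -(α * μ) by ring, ← hc]
            group
      _ = _ := by rw [h.inv_commR_mul_pow]
  have e3 : b⁻¹ * (a⁻¹ * c ^ k * a) * b = c⁻¹ * (a⁻¹ * (b⁻¹ * c ^ k * b) * a) * c := by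
    have : a * b = b * a * c := mul_eq_mul_mul_commR a b
    calc _ = (a * b)⁻¹ * c ^ k * (a * b) := by group
      _ = _ := by rw [this]; group
  rw [e1, e2] at e3
  have e4 := h.commR_pow_mul_zpow (μ : ℤ) μ
  have e5 := h.zpow_mul_commR_pow (-(α * μ)) μ
  rw [← hc] at e4 e5
  have e6 : b ^ ((μ : ℤ) * α ^ μ) * (c ^ (μ + k) * a ^ (-(α * geomSum α μ))) =
      b ^ geomSum α μ * (c ^ (k + μ) * a ^ (-(α * μ) * α ^ μ)) := by
    calc b ^ ((μ : ℤ) * α ^ μ) * (c ^ (μ + k) * a ^ (-(α * geomSum α μ)))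
        = c ^ μ * (b ^ (μ : ℤ) * c ^ k * (a ^ (-(α * geomSum α μ)) * (c ^ μ)⁻¹)) * c ^ μ := by
          rw [pow_add, ← mul_assoc, ← mul_assoc, ← e4]; group
      _ = b ^ geomSum α μ * c ^ k * (a ^ (-(α * μ)) * c ^ μ) := by rw [e3]; group
      _ = _ := by rw [e5, pow_add]; group
  rw [add_comm k μ] at e6
  rw [defect, sub_eq_neg_add, zpow_add, mul_assoc, zpow_neg, inv_mul_eq_iff_eq_mul]
  calc b ^ ((μ : ℤ) * α ^ μ) * c ^ (μ + k)
      = b ^ ((μ : ℤ) * α ^ μ) * (c ^ (μ + k) * a ^ (-(α * geomSum α μ))) * a ^ (α * geomSum α μ) := by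
        group
    _ = _ := by
        rw [e6, mul_assoc, mul_assoc, ← zpow_add]
        congr 3
        ring

/-- A power of `b` coincides with a power of `a`. -/
theorem zpow_defect_eq (h : IsMacdonaldPair α a b) {k μ : ℕ} (hμ : (μ : ℤ) = α ^ k - 1) :
    b ^ (defect α μ * α ^ (μ + k)) = a ^ (-(α * defect α μ)) := by
  have e1 := h.zpow_defect_mul_commR_pow hμ
  have e2 := h.zpow_mul_commR_pow (-(α * defect α μ)) (μ + k)
  -- `b ^ defect` is the conjugate of a power of `a` by a power of `c`. Raising to the power `α ^ (μ
  -- + k)` cancels the effect of that conjugation.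
  have e3 : b ^ defect α μ =
      commR a b ^ (μ + k) * a ^ (-(α * defect α μ)) * (commR a b ^ (μ + k))⁻¹ :=
    eq_mul_inv_of_mul_eq e1
  rw [zpow_mul, e3, conj_zpow, ← zpow_mul, ← e2, mul_inv_cancel_right]

theorem commute_commR {x : T} (ha : Commute x a) (hb : Commute x b) : Commute x (commR a b) :=
  ((ha.inv_right.mul_right hb.inv_right).mul_right ha).mul_right hb

/-- Such a power commutes with `c` as well, while conjugation by `c` raises it to the power `α`. -/
theorem zpow_eq_one_of_commute (h : IsMacdonaldPair α a b) {i : ℤ} (hi : Commute (a ^ i) b) :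
    a ^ (i * (α - 1)) = 1 := by
  have h1 := h.zpow_mul_commR i
  rw [(commute_commR (Commute.zpow_self a i) hi).eq] at h1
  have h2 := mul_left_cancel h1
  rw [mul_sub, zpow_sub, ← h2, mul_one, mul_inv_cancel]

theorem commute_zpow_defect (h : IsMacdonaldPair α a b) {k μ : ℕ} (hμ : (μ : ℤ) = α ^ k - 1) :
    Commute (a ^ (α * defect α μ)) b := by
  have h1 := h.zpow_defect_eq hμ
  rw [zpow_neg] at h1
  rw [← Commute.inv_left_iff, ← h1]
  exact Commute.zpow_self b _

/-- If it vanished, the geometric sum would be a multiple of `α`, whereas it is congruent to `1`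
modulo `α`. -/
theorem defect_ne_zero {μ : ℕ} (h0 : 2 ≤ |α|) (hμ : 0 < μ) : defect α μ ≠ 0 := by
  intro h0'
  have h1 := geomSum_mul α μ
  rw [defect, sub_eq_zero] at h0'
  have h2 : α ∣ 1 := by
    rw [← h0'] at h1
    have : α ∣ α ^ μ := dvd_pow_self _ hμ.ne'
    have h3 : (1 : ℤ) = α ^ μ - μ * α ^ μ * (α - 1) := by linarith
    rw [h3]
    exact dvd_sub this (Dvd.dvd.mul_right (Dvd.dvd.mul_left this _) _)
  have := Int.isUnit_iff_abs_eq.1 (isUnit_of_dvd_one h2)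
  omega

theorem isOfFinOrder_left (h : IsMacdonaldPair α a b) (h0 : 2 ≤ |α|) : IsOfFinOrder a := by
  have h4 : 4 ≤ α ^ 2 := by nlinarith [sq_abs α]
  -- Taking `k = 2` makes `α ^ k - 1` a natural number for negative `α` too.
  obtain ⟨μ, hμ⟩ := Int.eq_ofNat_of_zero_le (show 0 ≤ α ^ 2 - 1 by omega)
  have h1 := h.zpow_eq_one_of_commute (h.commute_zpow_defect hμ.symm)
  refine isOfFinOrder_iff_zpow_eq_one.2 ⟨_, ?_, h1⟩
  have h2 := defect_ne_zero (μ := μ) h0 (by omega)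
  have h3 : α ≠ 0 := by rintro rfl; simp at h0
  have h5 : α - 1 ≠ 0 := fun h => by
    have : α = 1 := by omega
    subst this; simp at h0
  exact mul_ne_zero (mul_ne_zero h3 h2) h5

/-- If `g` divides both `α` and the order `g * y` of `a`, then conjugation by `c` sends `a ^ y` to
`a ^ (y * α) = 1`, so `a ^ y = 1` and `g` is a unit. -/
theorem isCoprime_orderOf (h : IsMacdonaldPair α a b) (ha : IsOfFinOrder a) :
    IsCoprime α (orderOf a) := by
  rw [Int.isCoprime_iff_gcd_eq_one]
  obtain ⟨x, hx⟩ := Int.gcd_dvd_left α (orderOf a)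
  obtain ⟨y, hy⟩ := Int.gcd_dvd_right α (orderOf a)
  set g := Int.gcd α (orderOf a)
  have hn : (orderOf a : ℤ) ≠ 0 := by exact_mod_cast ha.orderOf_pos.ne'
  have h1 := h.zpow_mul_commR y
  have h2 : a ^ (y * α) = 1 := by
    rw [← orderOf_dvd_iff_zpow_eq_one]
    exact ⟨x, by rw [hx]; linear_combination (-x) * hy⟩
  rw [h2, mul_one, mul_eq_right, ← orderOf_dvd_iff_zpow_eq_one] at h1
  obtain ⟨w, hw⟩ := h1
  have h3 : (orderOf a : ℤ) * (g * w) = orderOf a * 1 := by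
    linear_combination (-(g : ℤ)) * hw - hy
  have h4 := mul_left_cancel₀ hn h3
  have := Int.isUnit_iff.1 (IsUnit.of_mul_eq_one _ h4)
  omega

/-- For `n` the order of `a`, `conj_pow` makes `c ^ n` a power of `a`. It therefore commutes with
`a`, although conjugation by it raises `a` to the power `α ^ n`. -/
theorem orderOf_dvd_pow_sub_one (h : IsMacdonaldPair α a b) :
    (orderOf a : ℤ) ∣ α ^ orderOf a - 1 := by
  have h1 := h.conj_pow (orderOf a)
  rw [pow_orderOf_eq_one, mul_one, inv_mul_cancel, eq_comm, mul_eq_one_iff_eq_inv,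
    ← zpow_neg] at h1
  have h2 := h.zpow_mul_commR_pow 1 (orderOf a)
  rw [h1, zpow_one, one_mul, ← zpow_add, ← zpow_one_add] at h2
  rw [← orderOf_dvd_sub_iff_zpow_eq_zpow] at h2
  obtain ⟨w, hw⟩ := h2
  exact ⟨-w, by linear_combination -hw⟩

/-- Every prime factor of the order of `a` divides `α - 1`. -/
theorem dvd_sub_one_of_prime_dvd_orderOf {α : ℕ} (h : IsMacdonaldPair (α : ℤ) a b) (hα : 2 ≤ α)
    (ha : IsOfFinOrder a) {r : ℕ} (hr : r.Prime) (hra : r ∣ orderOf a) : (r : ℤ) ∣ α - 1 := by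
  have : Fact r.Prime := ⟨hr⟩
  by_contra hcon
  have hrα : ¬ (r : ℤ) ∣ α := fun hd => by
    have := (h.isCoprime_orderOf ha).isUnit_of_dvd' hd (Int.natCast_dvd_natCast.2 hra)
    rw [Int.isUnit_iff_natAbs_eq, Int.natAbs_natCast] at this
    exact hr.one_lt.ne' this
  set x : ZMod r := (α : ZMod r) with hx
  have hx0 : x ≠ 0 := by
    intro h0
    apply hrα
    rwa [← ZMod.intCast_zmod_eq_zero_iff_dvd, Int.cast_natCast]
  have hx1 : x - 1 ≠ 0 := by
    intro h0
    apply hcon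
    rw [← ZMod.intCast_zmod_eq_zero_iff_dvd]
    push_cast
    exact h0
  -- If `r` did not divide `α - 1`, it would divide every `defect α (α ^ k - 1)`. Multiplied by `α -
  -- 1`, this divisibility reads as follows in `ZMod r`.
  have key : ∀ k : ℕ, x ^ (α ^ k - 1) * ((x ^ k - 1) * (x - 1) - 1) = -1 := by
    intro k
    have h1 : 1 ≤ α ^ k := Nat.one_le_pow _ _ (by omega)
    have hμ : ((α ^ k - 1 : ℕ) : ℤ) = (α : ℤ) ^ k - 1 := by push_cast [h1]; ring
    have h2 := h.zpow_eq_one_of_commute (h.commute_zpow_defect hμ)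
    rw [← orderOf_dvd_iff_zpow_eq_one] at h2
    have h3 := (Int.natCast_dvd_natCast.2 hra).trans h2
    have hrp := Nat.prime_iff_prime_int.1 hr
    have h4 : (r : ℤ) ∣ defect α (α ^ k - 1) := by
      rcases hrp.dvd_or_dvd h3 with h5 | h5
      · exact (hrp.dvd_or_dvd h5).resolve_left hrα
      · exact absurd h5 hcon
    have h5 := geomSum_mul α (α ^ k - 1)
    have h6 := h4.mul_right ((α : ℤ) - 1)
    rw [defect, sub_mul, h5, hμ, ← ZMod.intCast_zmod_eq_zero_iff_dvd] at h6
    push_cast at h6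
    rw [← hx] at h6
    linear_combination h6
  set d := orderOf x with hd
  have hdn : d ∣ orderOf a := by
    rw [orderOf_dvd_iff_pow_eq_one, ← sub_eq_zero]
    have h1 := (Int.natCast_dvd_natCast.2 hra).trans h.orderOf_dvd_pow_sub_one
    rw [← ZMod.intCast_zmod_eq_zero_iff_dvd] at h1
    push_cast at h1
    exact h1
  have hd0 : 0 < d := Nat.pos_of_dvd_of_pos hdn ha.orderOf_pos
  have hd1 : 1 < d := by
    by_contra hle
    have : d = 1 := by omega
    rw [hd, orderOf_eq_one_iff] at this
    exact hx1 (by rw [this, sub_self])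
  have hcop : α.Coprime d := by
    have h1 := (h.isCoprime_orderOf ha).of_isCoprime_of_dvd_right (Int.natCast_dvd_natCast.2 hdn)
    exact Nat.isCoprime_iff_coprime.1 h1
  -- As `α` is prime to `d`, the values `k = 1` and `k = 1 + φ(d)` give the same power of `x` in
  -- `key`. Comparing them yields `x ^ φ(d) = 1`, so `d ≤ φ(d)`, which is impossible for `d > 1`.
  have htot : α ^ d.totient ≡ 1 [MOD d] := Nat.ModEq.pow_totient hcop
  have h1 := key 1
  have h2 := key (1 + d.totient)
  have h3 : x ^ (α ^ (1 + d.totient) - 1) = x ^ (α ^ 1 - 1) := by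
    suffices hmod : α ^ (1 + d.totient) - 1 ≡ α ^ 1 - 1 [MOD d] by
      rw [← pow_mod_orderOf x (α ^ (1 + d.totient) - 1), ← pow_mod_orderOf x (α ^ 1 - 1), ← hd, hmod]
    have : α ^ (1 + d.totient) ≡ α ^ 1 [MOD d] := by
      rw [pow_add]
      simpa only [mul_one] using htot.mul_left (α ^ 1)
    refine Nat.ModEq.add_right_cancel' 1 ?_
    rwa [Nat.sub_add_cancel (Nat.one_le_pow _ _ (by omega)),
      Nat.sub_add_cancel (Nat.one_le_pow _ _ (by omega))]
  rw [h3, ← h1] at h2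
  have h4 := mul_left_cancel₀ (pow_ne_zero _ hx0) h2
  have h5 : x * (x - 1) * (x ^ d.totient - 1) = 0 := by
    linear_combination h4
  have h6 : x ^ d.totient = 1 := by
    have := (mul_eq_zero.1 h5).resolve_left (mul_ne_zero hx0 hx1)
    exact sub_eq_zero.1 this
  have h7 := Nat.le_of_dvd (Nat.totient_pos.2 hd0) (orderOf_dvd_of_pow_eq_one h6)
  exact absurd (Nat.totient_lt d hd1) (by omega)

end IsMacdonaldPair

/-! ### Divisibility of geometric sums. -/

theorem geomSum_mul_index (α : ℤ) (k l : ℕ) :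
    geomSum α (k * l) = geomSum α k * geomSum (α ^ k) l := by
  induction l with
  | zero => simp [geomSum]
  | succ l ih =>
    rw [geomSum_succ, mul_add_one, mul_add (geomSum α k), ← ih, geomSum, Finset.sum_range_add]
    simp only [geomSum, Finset.sum_mul, ← pow_mul, pow_add, mul_comm (α ^ (k * l))]

theorem dvd_geomSum_of_dvd_sub_one {α : ℤ} {q : ℕ} (h : (q : ℤ) ∣ α - 1) : (q : ℤ) ∣ geomSum α q := by
  have h1 : ∀ i, α ^ i ≡ 1 [ZMOD q] := fun i => by
    have : α ≡ 1 [ZMOD q] := (Int.modEq_iff_dvd.2 h).symm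
    simpa using this.pow i
  rw [← Int.modEq_zero_iff_dvd, geomSum]
  calc ∑ i ∈ Finset.range q, α ^ i ≡ ∑ i ∈ Finset.range q, 1 [ZMOD q] :=
        Int.ModEq.sum fun i _ => h1 i
    _ ≡ 0 [ZMOD q] := by simp

/-- `geomSum_mul_index` reduces the claim to prime `k`, where every term of the sum is `1` modulo
`k`. -/
theorem dvd_geomSum {α : ℤ} {k : ℕ} (hk : k ≠ 0)
    (h : ∀ q : ℕ, q.Prime → q ∣ k → (q : ℤ) ∣ α - 1) : (k : ℤ) ∣ geomSum α k := by
  induction k using Nat.recOnMul generalizing α with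
  | zero => exact absurd rfl hk
  | one => simp
  | prime q hq => exact dvd_geomSum_of_dvd_sub_one (h q hq dvd_rfl)
  | mul x y hx hy =>
    have hx0 : x ≠ 0 := left_ne_zero_of_mul hk
    have hy0 : y ≠ 0 := right_ne_zero_of_mul hk
    rw [geomSum_mul_index, Nat.cast_mul]
    exact mul_dvd_mul (hx hx0 fun q hq hqx => h q hq (hqx.mul_right y)) <|
      hy hy0 fun q hq hqy => (h q hq (hqy.mul_left x)).trans (by simpa using sub_dvd_pow_sub_pow α 1 x)

theorem mul_dvd_pow_sub_one {α : ℤ} {k q : ℕ} (hk : k ≠ 0) (hq : (q : ℤ) ∣ α - 1)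
    (h : ∀ q : ℕ, q.Prime → q ∣ k → (q : ℤ) ∣ α - 1) : ((k * q : ℕ) : ℤ) ∣ α ^ k - 1 := by
  rw [← geomSum_mul, Nat.cast_mul]
  exact mul_dvd_mul (dvd_geomSum hk h) hq

/-! ### Groups generated by two elements. -/

section Generation

variable {T : Type*} [Group T] {a b : T}

theorem commute_of_closure_pair (hab : Subgroup.closure {a, b} = ⊤) {x : T} (ha : Commute x a)
    (hb : Commute x b) : x ∈ Subgroup.center T := by
  rw [← Subgroup.centralizer_univ, ← Subgroup.coe_top, ← hab, Subgroup.centralizer_closure,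
    Subgroup.mem_centralizer_iff]
  rintro y (rfl | rfl)
  exacts [ha.symm, hb.symm]

theorem closure_pair_map {U : Type*} [Group U] (hab : Subgroup.closure {a, b} = ⊤) (f : T →* U)
    (hf : Function.Surjective f) : Subgroup.closure {f a, f b} = ⊤ := by
  rw [← Set.image_pair, ← MonoidHom.map_closure, hab, Subgroup.map_top_of_surjective f hf]

theorem finite_of_comm_of_closure_pair {T : Type*} [CommGroup T] {a b : T}
    (hab : Subgroup.closure {a, b} = ⊤) (ha : IsOfFinOrder a) (hb : IsOfFinOrder b) : Finite T := by
  have : Group.FG T := Group.fg_iff.2 ⟨_, hab, Set.toFinite _⟩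
  refine CommGroup.finite_of_fg_isMulTorsion T fun x => ?_
  have hx : x ∈ Subgroup.closure {a, b} := hab ▸ Subgroup.mem_top x
  induction hx using Subgroup.closure_induction with
  | mem x hx => rcases hx with rfl | rfl <;> assumption
  | one => exact IsOfFinOrder.one
  | mul x y _ _ hx hy => exact hx.mul hy
  | inv x _ hx => exact hx.inv

/-- Schur's theorem: a centre of finite index makes the commutator subgroup finite, and the
abelianization is generated by two elements of finite order. -/
theorem finite_of_finite_quotient_center (hab : Subgroup.closure {a, b} = ⊤)
    (ha : IsOfFinOrder a) (hb : IsOfFinOrder b) [Finite (T ⧸ Subgroup.center T)] : Finite T := by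
  have h1 : Finite (commutatorSet T) := by
    -- A commutator depends only on the classes of its entries modulo the centre, so there are
    -- finitely many commutators.
    let f : (T ⧸ Subgroup.center T) × (T ⧸ Subgroup.center T) → T :=
      fun x => x.1.out * x.2.out * x.1.out⁻¹ * x.2.out⁻¹
    refine ((Set.finite_range f).subset ?_).to_subtype
    rintro _ ⟨x, y, rfl⟩
    obtain ⟨u, hu⟩ := QuotientGroup.mk_out_eq_mul (Subgroup.center T) x
    obtain ⟨v, hv⟩ := QuotientGroup.mk_out_eq_mul (Subgroup.center T) y
    refine ⟨(x, y), ?_⟩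
    have hu' := Subgroup.mem_center_iff.1 u.2
    have hv' := Subgroup.mem_center_iff.1 v.2
    simp only [f, hu, hv, commutatorElement_def, mul_inv_rev]
    calc x * u * (y * v) * ((u : T)⁻¹ * x⁻¹) * ((v : T)⁻¹ * y⁻¹)
        = x * (u * (y * v)) * ((u : T)⁻¹ * x⁻¹) * ((v : T)⁻¹ * y⁻¹) := by group
      _ = x * (y * ((v * x⁻¹) * (v : T)⁻¹)) * y⁻¹ := by rw [← hu']; group
      _ = x * y * x⁻¹ * y⁻¹ := by rw [← hv']; group
  have h2 : Finite (commutator T) := inferInstance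
  have h3 : Finite (Abelianization T) :=
    finite_of_comm_of_closure_pair (closure_pair_map hab Abelianization.of
      (QuotientGroup.mk'_surjective _)) (MonoidHom.isOfFinOrder _ ha) (MonoidHom.isOfFinOrder _ hb)
  have h4 : Finite (T ⧸ commutator T) := h3
  exact Finite.of_subgroup_quotient (commutator T)

theorem pow_conj_eq_zpow {x y : T} {t : ℤ} (h : y⁻¹ * x * y = x ^ t) (j : ℕ) :
    (y ^ j)⁻¹ * x * y ^ j = x ^ t ^ j := by
  induction j with
  | zero => simp
  | succ j ih =>
    have h1 := conj_zpow (a := y⁻¹) (b := x) (i := t ^ j)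
    rw [inv_inv, h, ← zpow_mul, ← pow_succ'] at h1
    rw [h1, ← ih, pow_succ]
    group

/-- An element of order prime to `q - 1` normalizing a group of order `q` centralizes it. -/
theorem commute_of_conj_eq_zpow {x y : T} {t : ℤ} {q n : ℕ} (hq : q.Prime) (hx : x ^ q = 1)
    (hn0 : n ≠ 0) (hy : y ^ n = 1) (hn : n.Coprime (q - 1)) (h : y⁻¹ * x * y = x ^ t) : Commute x y := by
  have : Fact q.Prime := ⟨hq⟩
  rcases (Nat.dvd_prime hq).1 (orderOf_dvd_of_pow_eq_one hx) with h1 | h1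
  · rw [orderOf_eq_one_iff.1 h1]
    exact Commute.one_left y
  have h2 := pow_conj_eq_zpow h n
  rw [hy, inv_one, one_mul, mul_one] at h2
  have h3 : ((t : ZMod q)) ^ n = 1 := by
    have h4 : x ^ (t ^ n) = x ^ (1 : ℤ) := by rw [← h2, zpow_one]
    rw [← orderOf_dvd_sub_iff_zpow_eq_zpow, h1, ← ZMod.intCast_zmod_eq_zero_iff_dvd] at h4
    push_cast at h4
    exact sub_eq_zero.1 h4
  have h5 : (t : ZMod q) = 1 := by
    have ht : (t : ZMod q) ≠ 0 := by
      intro h0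
      rw [h0, zero_pow hn0] at h3
      exact zero_ne_one h3
    have h6 := ZMod.pow_card_sub_one_eq_one ht
    rw [← orderOf_eq_one_iff, ← Nat.dvd_one, ← hn]
    exact Nat.dvd_gcd (orderOf_dvd_of_pow_eq_one h3) (orderOf_dvd_of_pow_eq_one h6)
  have h6 : x ^ t = x := by
    conv_rhs => rw [← zpow_one x]
    rw [← orderOf_dvd_sub_iff_zpow_eq_zpow, h1, ← ZMod.intCast_zmod_eq_zero_iff_dvd]
    push_cast
    exact sub_eq_zero.2 h5
  rw [h6, mul_assoc, inv_mul_eq_iff_eq_mul] at h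
  exact h

end Generation

/-! ### Nilpotency and finiteness. -/

theorem coprime_minFac_sub_one {n : ℕ} (h2 : n.minFac ≠ 1) :
    n.Coprime (n.minFac - 1) := by
  have := n.minFac_pos
  exact Nat.coprime_of_lt_minFac (by omega) (by omega)

/-- Once `c ^ k = 1`, `conj_pow` shows that `b` sends `a ^ k` to a power of itself. The order of `a
^ k` divides the prime `q`, and that of `b` is prime to `q - 1`, so the two commute. -/
theorem IsMacdonaldPair.pow_mem_center {α : ℤ} {n k q : ℕ} (hn : n ≠ 0) (hnk : n = k * q)
    (hq : q.Prime) (hcop : n.Coprime (q - 1))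
    (hprime : ∀ q : ℕ, q.Prime → q ∣ n → (q : ℤ) ∣ α - 1) {T : Type*} [Group T] {a b : T}
    (h : IsMacdonaldPair α a b) (hab : Subgroup.closure {a, b} = ⊤) (ha : a ^ n = 1)
    (hb : b ^ n = 1) (hc : commR a b ^ k = 1) : a ^ k ∈ Subgroup.center T := by
  have hk : k ≠ 0 := by rintro rfl; simp at hnk; exact hn hnk
  obtain ⟨t, ht⟩ := dvd_geomSum hk fun r hr hrk => hprime r hr (hnk ▸ hrk.mul_right q)
  refine commute_of_closure_pair hab (Commute.pow_self a k) ?_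
  refine commute_of_conj_eq_zpow (t := α * t) hq (by rw [← pow_mul, ← hnk, ha]) hn hb hcop ?_
  rw [h.conj_pow, hc, one_mul, ht, ← zpow_natCast, ← zpow_mul]
  congr 1
  ring

/-- Induction on `n = k * q`, with `q` the least prime factor so that `n` is prime to `q - 1`. As
`n` divides `α ^ k - 1`, `c ^ k` is central. Modulo the centre, `a ^ k` and `b ^ k` become central,
so two central quotients reduce the exponent `n` to `k`. -/
theorem IsMacdonaldPair.isNilpotent_and_finite {α : ℤ} (n : ℕ) (hn : n ≠ 0)
    (hprime : ∀ q : ℕ, q.Prime → q ∣ n → (q : ℤ) ∣ α - 1) {T : Type*} [Group T] {a b : T}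
    (h : IsMacdonaldPair α a b) (hab : Subgroup.closure {a, b} = ⊤) (ha : a ^ n = 1)
    (hb : b ^ n = 1) : Group.IsNilpotent T ∧ Finite T := by
  induction n using Nat.strong_induction_on generalizing T with
  | _ n ih =>
  rcases eq_or_ne n 1 with rfl | hn1
  · have : Subsingleton T := by
      rw [pow_one] at ha hb
      subst ha hb
      refine Subgroup.subsingleton_iff.1 (subsingleton_of_bot_eq_top ?_)
      rw [← hab, eq_comm, Subgroup.closure_eq_bot_iff]
      simp
    exact ⟨inferInstance, inferInstance⟩
  have hq := Nat.minFac_prime hn1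
  have hcop := coprime_minFac_sub_one hq.ne_one
  obtain ⟨k, hnk⟩ := Nat.minFac_dvd n
  set q := n.minFac with hq_def
  rw [mul_comm] at hnk
  have hk : k ≠ 0 := by rintro rfl; simp at hnk; exact hn hnk
  have hprime' : ∀ r : ℕ, r.Prime → r ∣ k → (r : ℤ) ∣ α - 1 :=
    fun r hr hrk => hprime r hr (hnk ▸ hrk.mul_right q)
  have hfa : IsOfFinOrder a := isOfFinOrder_iff_pow_eq_one.2 ⟨n, Nat.pos_of_ne_zero hn, ha⟩
  have hfb : IsOfFinOrder b := isOfFinOrder_iff_pow_eq_one.2 ⟨n, Nat.pos_of_ne_zero hn, hb⟩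
  have hdvd : ((k * q : ℕ) : ℤ) ∣ α ^ k - 1 :=
    mul_dvd_pow_sub_one hk (hprime q hq (Nat.minFac_dvd n)) hprime'
  rw [← hnk] at hdvd
  obtain ⟨w, hw⟩ := hdvd
  have hw' : α ^ k = 1 + n * w := by linear_combination hw
  have hc : commR a b ^ k ∈ Subgroup.center T := by
    refine commute_of_closure_pair hab ?_ ?_
    · have h1 := h.zpow_mul_commR_pow 1 k
      rw [one_mul, hw', zpow_add, zpow_mul, zpow_natCast, ha, one_zpow, mul_one, zpow_one] at h1
      exact h1.symm
    · have h1 := h.commR_pow_mul_zpow 1 k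
      rwa [one_mul, hw', zpow_add, zpow_mul, zpow_natCast, hb, one_zpow, mul_one, zpow_one] at h1
  let f := QuotientGroup.mk' (Subgroup.center T)
  have hf : Function.Surjective f := QuotientGroup.mk'_surjective _
  have h1 := h.map f
  have hab1 := closure_pair_map hab f hf
  have ha1 : f a ^ n = 1 := by rw [← map_pow, ha, map_one]
  have hb1 : f b ^ n = 1 := by rw [← map_pow, hb, map_one]
  have hc1 : commR (f a) (f b) ^ k = 1 := by
    rw [← map_commR, ← map_pow]
    exact (QuotientGroup.eq_one_iff _).2 hc
  have hA := h1.pow_mem_center hn hnk hq hcop hprime hab1 ha1 hb1 hc1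
  have hB := h1.swap.pow_mem_center hn hnk hq hcop hprime (by rwa [Set.pair_comm]) hb1 ha1
    (by rw [commR_swap, inv_pow, hc1, inv_one])
  let g := QuotientGroup.mk' (Subgroup.center (T ⧸ Subgroup.center T))
  have hg : Function.Surjective g := QuotientGroup.mk'_surjective _
  have hkn : k < n := by
    rw [hnk]
    exact lt_mul_of_one_lt_right (Nat.pos_of_ne_zero hk) hq.one_lt
  obtain ⟨hnil, hfin⟩ := ih k hkn hk hprime' (h1.map g) (closure_pair_map hab1 g hg)
    (by rw [← map_pow]; exact (QuotientGroup.eq_one_iff _).2 hA)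
    (by rw [← map_pow]; exact (QuotientGroup.eq_one_iff _).2 hB)
  have hfin1 := finite_of_finite_quotient_center hab1 (f.isOfFinOrder hfa) (f.isOfFinOrder hfb)
  exact ⟨Group.of_quotient_center_nilpotent (Group.of_quotient_center_nilpotent hnil),
    finite_of_finite_quotient_center hab hfa hfb⟩

/-! ### Sylow subgroups of finite nilpotent groups. -/

/-- A Sylow subgroup of a finite nilpotent group is a quotient of the group, by a kernel that is
killed by every homomorphism to a `p`-group. -/
theorem Sylow.exists_projection {G : Type*} [Group G] [Finite G] [Group.IsNilpotent G] {p : ℕ}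
    [Fact p.Prime] (J : Sylow p G) :
    ∃ f : G →* J, Function.Surjective f ∧
      ∀ {H : Type*} [Group H] (_ : IsPGroup p H) (g : G →* H), f.ker ≤ g.ker := by
  have hnormal : ∀ {q : ℕ} [Fact q.Prime] (P : Sylow q G), (P : Subgroup G).Normal := by
    have h1 := (Group.isNilpotent_of_finite_tfae (G := G)).out 0 3
    exact fun {q} hq P => h1.1 inferInstance q hq P
  obtain ⟨f, hf⟩ : ∃ f : G →* J, Function.Surjective f := by
    by_cases hp : p ∈ (Nat.card G).primeFactors
    · let e := (Sylow.directProductOfNormal hnormal).symm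
      refine ⟨((Pi.evalMonoidHom (fun P : Sylow p G => P) J).comp
        (Pi.evalMonoidHom (fun q : (Nat.card G).primeFactors => ((P : Sylow q G) → P))
          ⟨p, hp⟩)).comp e.toMonoidHom, ?_⟩
      exact ((Function.surjective_eval J).comp
        (Function.surjective_eval (⟨p, hp⟩ : (Nat.card G).primeFactors))).comp e.surjective
    · refine ⟨1, ?_⟩
      have : Subsingleton J := by
        rw [← Finite.card_le_one_iff_subsingleton]
        rcases J.isPGroup'.card_eq_or_dvd with h | h
        · exact h.le
        · exact absurd (Nat.mem_primeFactors.2 ⟨Fact.out,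
            h.trans (Subgroup.card_subgroup_dvd_card _), Nat.card_pos.ne'⟩) hp
      exact fun x => ⟨1, Subsingleton.elim _ _⟩
  refine ⟨f, hf, fun {H} _ hH g x hx => ?_⟩
  -- The order of the kernel is the index of `J`, hence prime to `p`; its elements must die in any
  -- `p`-group.
  have hcard : Nat.card f.ker = (J : Subgroup G).index := by
    have h1 := Subgroup.card_mul_index f.ker
    have h2 := Subgroup.card_mul_index (J : Subgroup G)
    rw [Subgroup.index_ker, MonoidHom.range_eq_top.2 hf, Subgroup.card_top, ← h2, mul_comm] at h1
    exact mul_left_cancel₀ Nat.card_pos.ne' h1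
  have h1 : orderOf (g x) ∣ Nat.card f.ker :=
    (orderOf_map_dvd g x).trans (by
      rw [← Subgroup.orderOf_mk x hx]
      exact orderOf_dvd_natCard _)
  obtain ⟨k, hk⟩ := IsPGroup.iff_orderOf.1 hH (g x)
  rw [MonoidHom.mem_ker, ← orderOf_eq_one_iff]
  have h2 : (Nat.card f.ker).Coprime (p ^ k) := by
    rw [hcard]
    exact Nat.Coprime.pow_right _ ((Nat.Prime.coprime_iff_not_dvd Fact.out).2 J.not_dvd_index).symm
  rw [← Nat.dvd_one, ← h2]
  exact Nat.dvd_gcd h1 (hk ▸ dvd_rfl)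

theorem isPGroup_of_closure_pair {G : Type*} [Group G] [Finite G] [Group.IsNilpotent G] {p : ℕ}
    [Fact p.Prime] {a b : G} (hab : Subgroup.closure {a, b} = ⊤) {N : ℕ} (ha : a ^ p ^ N = 1)
    (hb : b ^ p ^ N = 1) : IsPGroup p G := by
  obtain ⟨P⟩ : Nonempty (Sylow p G) := inferInstance
  have hnormal : (P : Subgroup G).Normal := by
    have h1 := (Group.isNilpotent_of_finite_tfae (G := G)).out 0 3
    exact h1.1 inferInstance p inferInstance P
  have hmem : ∀ x : G, x ^ p ^ N = 1 → x ∈ P := by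
    intro x hx
    have h1 : IsPGroup p (Subgroup.zpowers x) := by
      refine IsPGroup.of_card_dvd_pow (n := N) ?_
      rw [Nat.card_zpowers]
      exact orderOf_dvd_of_pow_eq_one hx
    obtain ⟨Q, hQ⟩ := h1.exists_le_sylow
    have := Sylow.unique_of_normal P hnormal
    rw [Subsingleton.elim P Q]
    exact hQ (Subgroup.mem_zpowers x)
  have h1 : (P : Subgroup G) = ⊤ := by
    rw [eq_top_iff, ← hab, Subgroup.closure_le]
    rintro y (rfl | rfl)
    exacts [hmem _ ha, hmem _ hb]
  have h2 := P.isPGroup'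
  rw [h1] at h2
  exact h2.of_equiv Subgroup.topEquiv

/-! ### The presented group and its finiteness. -/

namespace MacdonaldGroup

variable {α : ℤ}

/-- The first generator. -/
def genA (α : ℤ) : MacdonaldGroup α := PresentedGroup.of 0

/-- The second generator. -/
def genB (α : ℤ) : MacdonaldGroup α := PresentedGroup.of 1

theorem isMacdonaldPair (α : ℤ) : IsMacdonaldPair α (genA α) (genB α) := by
  constructor
  · have h1 := PresentedGroup.one_of_mem (rels := macdonaldRels α) (Set.mem_insert _ _)
    rw [map_mul, map_inv, mul_inv_eq_one, map_conjBy, map_commR, map_zpow] at h1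
    exact h1
  · have h1 := PresentedGroup.one_of_mem (rels := macdonaldRels α)
      (Set.mem_insert_of_mem _ rfl)
    rw [map_mul, map_inv, mul_inv_eq_one, map_conjBy, map_commR, map_zpow] at h1
    exact h1

theorem closure_gen (α : ℤ) : Subgroup.closure {genA α, genB α} = ⊤ := by
  rw [← PresentedGroup.closure_range_of (macdonaldRels α)]
  congr 1
  ext x
  simp [genA, genB, Fin.exists_fin_two, eq_comm]

/-- The homomorphism determined by a pair satisfying the relations. -/
def lift {T : Type*} [Group T] {a b : T} (h : IsMacdonaldPair α a b) : MacdonaldGroup α →* T :=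
  PresentedGroup.toGroup (f := ![a, b]) (by
    rintro r (rfl | rfl)
    · rw [map_mul, map_inv, mul_inv_eq_one, map_conjBy, map_commR, map_zpow]
      simpa using h.conj_left
    · rw [map_mul, map_inv, mul_inv_eq_one, map_conjBy, map_commR, map_zpow]
      simpa using h.conj_right)

theorem lift_genA {T : Type*} [Group T] {a b : T} (h : IsMacdonaldPair α a b) :
    lift h (genA α) = a := by
  simp [lift, genA]

theorem lift_genB {T : Type*} [Group T] {a b : T} (h : IsMacdonaldPair α a b) :
    lift h (genB α) = b := by
  simp [lift, genB]

theorem isNilpotent_and_finite (hα : 2 ≤ |α|) :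
    Group.IsNilpotent (MacdonaldGroup α) ∧ Finite (MacdonaldGroup α) := by
  have h := isMacdonaldPair α
  have ha := h.isOfFinOrder_left hα
  have hb := h.swap.isOfFinOrder_left hα
  set a := genA α with ha_def
  set b := genB α with hb_def
  set n := orderOf a * orderOf b with hn
  have hn0 : 0 < n := Nat.mul_pos ha.orderOf_pos hb.orderOf_pos
  -- Modulo the orders of `a` and `b` the exponent `α` may be replaced by a natural number `β ≥ 2`,
  -- as the argument on prime factors requires.
  obtain ⟨β, hβ⟩ := Int.eq_ofNat_of_zero_le (show 0 ≤ α + n * (|α| + 2) by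
    nlinarith [neg_abs_le α, abs_nonneg α])
  have hβ2 : 2 ≤ β := by
    zify
    rw [← hβ]
    nlinarith [neg_abs_le α, abs_nonneg α]
  have h' : IsMacdonaldPair (β : ℤ) a b := by
    refine h.change_exponent ?_ ?_
    · rw [← orderOf_dvd_sub_iff_zpow_eq_zpow, ← hβ, add_sub_cancel_left, hn]
      push_cast
      exact ((dvd_mul_right _ _).mul_right _)
    · rw [← orderOf_dvd_sub_iff_zpow_eq_zpow, ← hβ, add_sub_cancel_left, hn]
      push_cast
      exact ((dvd_mul_left _ _).mul_right _)
  refine h'.isNilpotent_and_finite n hn0.ne' (fun q hq hqn => ?_) (closure_gen α) ?_ ?_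
  · rcases (Nat.Prime.dvd_mul hq).1 hqn with h1 | h1
    · exact h'.dvd_sub_one_of_prime_dvd_orderOf hβ2 ha hq h1
    · exact h'.swap.dvd_sub_one_of_prime_dvd_orderOf hβ2 hb hq h1
  · rw [← orderOf_dvd_iff_pow_eq_one]
    exact dvd_mul_right _ _
  · rw [← orderOf_dvd_iff_pow_eq_one]
    exact dvd_mul_left _ _

end MacdonaldGroup

/-! ### Polynomial identities behind the explicit model. -/

theorem two_mul_cast_choose_two (R : Type*) [CommRing R] (n : ℕ) :
    2 * ((n.choose 2 : ℕ) : R) = n * (n - 1) := by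
  induction n with
  | zero => simp
  | succ n ih =>
    rw [Nat.choose_succ_succ' n 1, Nat.choose_one_right]
    push_cast
    linear_combination ih

theorem six_mul_cast_choose_three (R : Type*) [CommRing R] (n : ℕ) :
    6 * ((n.choose 3 : ℕ) : R) = n * (n - 1) * (n - 2) := by
  induction n with
  | zero => simp
  | succ n ih =>
    rw [Nat.choose_succ_succ' n 2]
    have := two_mul_cast_choose_two R n
    push_cast
    linear_combination ih + 3 * this

namespace MacdonaldModel

variable {R : Type*} [CommRing R]

/-- The first coordinate of `modelD`; it interpolates `n ↦ ∑ i < n, (1 + 6 z) ^ i`. -/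
def modelSum (z n : R) : R := n + 3 * z * n * (n - 1) + 6 * z ^ 2 * n * (n - 1) * (n - 2)

/-- It interpolates `n ↦ (1 + 6 z) ^ (-n)`. -/
def modelExp (z n : R) : R := 1 - 6 * z * n + 18 * z ^ 2 * n * (n + 1)

/-- The action of `B⁻¹`. -/
def modelD (z : R) (v : R × R) : R × R := (modelSum z v.1, modelExp z v.1 * (v.2 - 1))

variable {z : R}

/-- Writing the base as `1 + 6 * z` clears the denominators `2` and `6` of the binomial
coefficients, so `p = 3` needs no separate treatment. The hypothesis `h9` expresses that `3` divides
a product of three consecutive integers, and `h27` kills the cubic terms. -/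
theorem modelSum_add_one (h27 : 27 * z ^ 3 = 0) (h9 : ∀ n : R, 9 * z ^ 3 * (n * (n - 1) * (n - 2)) = 0)
    (n : R) : modelSum z (n + 1) = 1 + (1 + 6 * z) * modelSum z n := by
  have := h9 n
  simp only [modelSum]
  grind

theorem modelExp_add (h27 : 27 * z ^ 3 = 0) (n n' : R) :
    modelExp z (n + n') = modelExp z n * modelExp z n' := by
  simp only [modelExp]
  grind

/-- The first coordinate of the `k`-th iterate of `modelD`, with `c = k.choose 2`. -/
def iterSum (z n k c : R) : R :=
  n + 3 * z * k * n * (n - 1) + 6 * z ^ 2 * k * n * (n - 1) * (n - 2) +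
    c * (9 * z ^ 2 * n * (n - 1) * (2 * n - 1) + 36 * z ^ 3 * n * (n - 1))

/-- The translation part of the second coordinate of the `k`-th iterate of `modelD`, with
`c = (k + 1).choose 2` and `d = (k + 1).choose 3`. -/
def iterShift (z n k c d : R) : R :=
  k - 6 * z * n * c + 9 * z ^ 2 * (4 * n * d + 2 * n * (n + 1) * c)

theorem modelSum_iterSum (h27 : 27 * z ^ 3 = 0)
    (h9 : ∀ n : R, 9 * z ^ 3 * (n * (n - 1) * (n - 2)) = 0) (n k c : R) :
    modelSum z (iterSum z n k c) = iterSum z n (k + 1) (c + k) := by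
  have := h9 n
  simp only [modelSum, iterSum]
  grind

theorem modelExp_iterSum (h27 : 27 * z ^ 3 = 0)
    (h9 : ∀ n : R, 9 * z ^ 3 * (n * (n - 1) * (n - 2)) = 0) (n k c : R) :
    modelExp z (iterSum z n k c) = modelExp z (n + 3 * z * k * n * (n - 1)) := by
  have := h9 n
  simp only [modelExp, iterSum]
  grind

theorem modelExp_mul_iterShift (h27 : 27 * z ^ 3 = 0) (n k c d : R) (hc : 2 * c = k * (k + 1)) :
    modelExp z (n + 3 * z * k * n * (n - 1)) * (iterShift z n k c d + 1) =
      iterShift z n (k + 1) (c + (k + 1)) (d + c) := by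
  simp only [modelExp, iterShift]
  grind

theorem iterate_modelD (h27 : 27 * z ^ 3 = 0)
    (h9 : ∀ n : R, 9 * z ^ 3 * (n * (n - 1) * (n - 2)) = 0) (v : R × R) (k : ℕ) :
    (modelD z)^[k] v = (iterSum z v.1 k (k.choose 2 : ℕ),
      modelExp z (k * v.1 + 3 * z * (k.choose 2 : ℕ) * v.1 * (v.1 - 1)) * v.2 -
        iterShift z v.1 k ((k + 1).choose 2 : ℕ) ((k + 1).choose 3 : ℕ)) := by
  induction k with
  | zero =>
    have : Nat.choose 1 3 = 0 := rfl
    simp [iterSum, iterShift, modelExp, this]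
  | succ k ih =>
    rw [Function.iterate_succ_apply', ih]
    have hc : 2 * (((k + 1).choose 2 : ℕ) : R) = k * (k + 1) := by
      rw [two_mul_cast_choose_two]
      push_cast
      ring
    have e1 : ((k + 1).choose 2 : ℕ) = k.choose 2 + k := by
      rw [Nat.choose_succ_succ' k 1, Nat.choose_one_right, add_comm]
    have e2 : ((k + 1 + 1).choose 2 : ℕ) = (k + 1).choose 2 + (k + 1) := by
      rw [Nat.choose_succ_succ' (k + 1) 1, Nat.choose_one_right, add_comm]
    have e3 : ((k + 1 + 1).choose 3 : ℕ) = (k + 1).choose 3 + (k + 1).choose 2 := by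
      rw [Nat.choose_succ_succ' (k + 1) 2, add_comm]
    have h1 := modelExp_mul_iterShift h27 v.1 k _ ((k + 1).choose 3 : ℕ) hc
    ext
    · simp only [modelD]
      rw [modelSum_iterSum h27 h9, e1]
      push_cast
      rfl
    · simp only [modelD]
      rw [e2, e3]
      push_cast
      rw [← h1, modelExp_iterSum h27 h9, sub_sub, mul_sub, ← mul_assoc, ← modelExp_add h27, e1]
      push_cast
      congr 3
      ring

/-- Together with `mul_modelExp_sub` this checks the relation `c b⁻¹ = b⁻ᵅ c` coordinate by
coordinate. Both coordinates show the same error `9 z² (z n - 2 n)`, which is why the model must be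
divided by `diag z`. -/
theorem mul_modelSum_sub (h27 : 27 * z ^ 3 = 0)
    (h9 : ∀ n : R, 9 * z ^ 3 * (n * (n - 1) * (n - 2)) = 0) (n c : R) (hc : 9 * z ^ 2 * c = 0) :
    (1 + 6 * z) * modelSum z n =
      iterSum z (modelSum z ((1 + 6 * z) * n)) (-6 * z + 36 * z ^ 2) c + 9 * z ^ 2 * (z * n - 2 * n) := by
  have := h9 n
  simp only [modelSum, iterSum]
  grind

theorem iterShift_eq (h27 : 27 * z ^ 3 = 0) (N μ c d : R) (hμ : μ = -6 * z + 36 * z ^ 2)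
    (hc : 2 * c = μ * (μ + 1)) (hd : 6 * d = (μ + 1) * μ * (μ - 1)) :
    iterShift z N μ c d = -6 * z + 36 * z ^ 2 - 18 * z ^ 2 * N * (6 * z - 1) + 36 * z ^ 3 * N := by
  have h1 : iterShift z N μ c d = μ - 3 * z * N * (2 * c) + 6 * z ^ 2 * N * (6 * d) +
      9 * z ^ 2 * N * (N + 1) * (2 * c) := by
    simp only [iterShift]; ring
  rw [h1, hc, hd, hμ]
  grind

theorem modelExp_iter_mul (h27 : 27 * z ^ 3 = 0) (n c w μ : R) (hμ : μ = -6 * z + 36 * z ^ 2)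
    (hc : 9 * z ^ 2 * c = 0) :
    modelExp z (μ * modelSum z ((1 + 6 * z) * n) + 3 * z * c * w) * modelExp z ((1 + 6 * z) * n) =
      modelExp z n := by
  rw [← modelExp_add h27]
  have h1 : ∀ x, modelExp z (x + 3 * z * c * w) = modelExp z x := fun x => by
    simp only [modelExp]
    grind
  rw [add_right_comm, h1, hμ]
  simp only [modelSum, modelExp]
  grind

theorem mul_modelExp_sub (h27 : 27 * z ^ 3 = 0)
    (n j α μ c c' d w : R)
    (hα : α = 1 - 6 * z + 36 * z ^ 2) (hμ : μ = -6 * z + 36 * z ^ 2) (hc : 9 * z ^ 2 * c = 0)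
    (hc' : 2 * c' = μ * (μ + 1)) (hd : 6 * d = (μ + 1) * μ * (μ - 1)) :
    α * (modelExp z n * (j - 1)) =
      modelExp z (μ * modelSum z ((1 + 6 * z) * n) + 3 * z * c * w) *
          (modelExp z ((1 + 6 * z) * n) * (α * j - 1)) -
        iterShift z (modelSum z ((1 + 6 * z) * n)) μ c' d + 9 * z ^ 2 * (z * n - 2 * n) := by
  rw [iterShift_eq h27 _ μ c' d hμ hc' hd, ← mul_assoc (modelExp z (_ + _)), modelExp_iter_mul h27 n c w μ hμ hc, hα]
  simp only [modelSum, modelExp]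
  grind

/-- The diagonal subgroup generated by `(9 z², 9 z²)`. -/
def diag (z : R) : AddSubgroup (R × R) :=
  (AddMonoidHom.prod (AddMonoidHom.mulLeft (9 * z ^ 2)) (AddMonoidHom.mulLeft (9 * z ^ 2))).range

theorem mem_diag {v : R × R} : v ∈ diag z ↔ ∃ r, 9 * z ^ 2 * r = v.1 ∧ 9 * z ^ 2 * r = v.2 := by
  simp [diag, Prod.ext_iff]

theorem iterate_modelD_sub_mem (h27 : 27 * z ^ 3 = 0)
    (h9 : ∀ n : R, 9 * z ^ 3 * (n * (n - 1) * (n - 2)) = 0) {α : ℕ} (hα0 : 0 < α)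
    (hα : (α : R) * (1 + 6 * z) = 1) (h2 : IsUnit (2 : R)) (v : R × R) :
    ((1 + 6 * z) * (modelD z v).1, α * (modelD z v).2) -
      (modelD z)^[α] ((1 + 6 * z) * v.1, α * v.2) ∈ diag z := by
  -- One iterate is split off; the remaining number `μ` of iterates is a multiple of `z` in `R`, so
  -- the closed form truncates.
  obtain ⟨μ, rfl⟩ : ∃ μ, α = μ + 1 := ⟨α - 1, by omega⟩
  have hα' : ((μ + 1 : ℕ) : R) = 1 - 6 * z + 36 * z ^ 2 := by
    linear_combination (1 - 6 * z + 36 * z ^ 2) * hα - 8 * (μ + 1 : ℕ) * h27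
  have hμ : (μ : R) = -6 * z + 36 * z ^ 2 := by
    push_cast at hα'
    linear_combination hα'
  have hc1 : 2 * ((μ.choose 2 : ℕ) : R) = μ * (μ - 1) := two_mul_cast_choose_two R μ
  have hc : 9 * z ^ 2 * ((μ.choose 2 : ℕ) : R) = 0 := by
    rw [← h2.mul_right_eq_zero]
    rw [hμ] at hc1
    linear_combination 9 * z ^ 2 * hc1 + (2 - 144 * z ^ 2 + 432 * z ^ 3) * h27
  have hc' : 2 * (((μ + 1).choose 2 : ℕ) : R) = μ * (μ + 1) := by
    rw [two_mul_cast_choose_two]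
    push_cast
    ring
  have hd : 6 * (((μ + 1).choose 3 : ℕ) : R) = (μ + 1) * μ * (μ - 1) := by
    rw [six_mul_cast_choose_three]
    push_cast
    ring
  rw [mem_diag]
  refine ⟨z * v.1 - 2 * v.1, ?_, ?_⟩
  · rw [Function.iterate_succ_apply, iterate_modelD h27 h9]
    have := mul_modelSum_sub h27 h9 v.1 _ hc
    simp only [modelD, Prod.fst_sub, hμ]
    rw [this]
    ring
  · rw [Function.iterate_succ_apply, iterate_modelD h27 h9]
    have := mul_modelExp_sub h27 v.1 v.2 (μ + 1 : ℕ) μ (μ.choose 2 : ℕ) _ _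
      (modelSum z ((1 + 6 * z) * v.1) * (modelSum z ((1 + 6 * z) * v.1) - 1)) hα' hμ hc hc' hd
    simp only [modelD, Prod.snd_sub]
    rw [this, ← mul_assoc (3 * z * _)]
    ring

end MacdonaldModel

/-! ### The model as a group of permutations. -/

namespace MacdonaldModel

variable {R : Type*} [CommRing R] {z : R}

/-- A map compatible with the equivalence relation modulo `diag z`. -/
def Compat (z : R) (f : R × R → R × R) : Prop := ∀ v w, v - w ∈ diag z → f v - f w ∈ diag z

theorem Compat.iterate {f : R × R → R × R} (hf : Compat z f) (k : ℕ) : Compat z f^[k] := by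
  induction k with
  | zero => exact fun v w h => h
  | succ k ih => exact fun v w h => ih _ _ (hf _ _ h)

/-- The permutation of the quotient induced by a compatible bijection. -/
def quotPerm (f g : R × R → R × R) (hf : Compat z f) (hg : Compat z g) (hfg : ∀ v, f (g v) = v)
    (hgf : ∀ v, g (f v) = v) : Equiv.Perm ((R × R) ⧸ diag z) where
  toFun := Quotient.map' f fun v w h => by
    rw [QuotientAddGroup.leftRel_apply, neg_add_eq_sub] at h ⊢
    exact hf _ _ h
  invFun := Quotient.map' g fun v w h => by
    rw [QuotientAddGroup.leftRel_apply, neg_add_eq_sub] at h ⊢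
    exact hg _ _ h
  left_inv x := by
    induction x using Quotient.inductionOn' with
    | h v => exact congrArg _ (hgf v)
  right_inv x := by
    induction x using Quotient.inductionOn' with
    | h v => exact congrArg _ (hfg v)

theorem compat_modelD (h27 : 27 * z ^ 3 = 0) : Compat z (modelD z) := by
  intro v w h
  rw [mem_diag] at h ⊢
  obtain ⟨r, h1, h2⟩ := h
  refine ⟨r, ?_, ?_⟩
  · have e : v.1 = w.1 + 9 * z ^ 2 * r := by rw [h1]; simp
    simp only [modelD, Prod.fst_sub, e, modelSum]
    grind
  · have e : v.1 = w.1 + 9 * z ^ 2 * r := by rw [h1]; simp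
    have e' : v.2 = w.2 + 9 * z ^ 2 * r := by rw [h2]; simp
    simp only [modelD, Prod.snd_sub, e, e', modelExp]
    grind

theorem compat_add (u : R × R) : Compat z (· + u) := fun _v _w h => by simpa using h

theorem compat_sub (u : R × R) : Compat z (· - u) := fun _v _w h => by simpa using h

/-- The action of `A`. -/
def permA (z : R) : Equiv.Perm ((R × R) ⧸ diag z) :=
  quotPerm (fun v => v + (1, 0)) (fun v => v - (1, 0)) (compat_add _) (compat_sub _)
    (fun _ => sub_add_cancel _ _) (fun _ => add_sub_cancel_right _ _)

theorem compat_smul {α β : R} (hα : 9 * z ^ 2 * α = 9 * z ^ 2) (hβ : 9 * z ^ 2 * β = 9 * z ^ 2) :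
    Compat z fun v => (α * v.1, β * v.2) := by
  intro v w h
  rw [mem_diag] at h ⊢
  obtain ⟨r, h1, h2⟩ := h
  refine ⟨r, ?_, ?_⟩
  · simp only [Prod.fst_sub] at h1 ⊢
    linear_combination α * h1 - r * hα
  · simp only [Prod.snd_sub] at h2 ⊢
    linear_combination β * h2 - r * hβ

theorem sq_mul_eq (h27 : 27 * z ^ 3 = 0) : 9 * z ^ 2 * (1 + 6 * z) = 9 * z ^ 2 := by
  linear_combination 2 * h27

theorem sq_mul_inv_eq (h27 : 27 * z ^ 3 = 0) {α : R} (hα : α * (1 + 6 * z) = 1) :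
    9 * z ^ 2 * α = 9 * z ^ 2 := by
  linear_combination 9 * z ^ 2 * hα - 2 * α * h27

/-- The action of `C`. -/
def permC (h27 : 27 * z ^ 3 = 0) {α : R} (hα : α * (1 + 6 * z) = 1) :
    Equiv.Perm ((R × R) ⧸ diag z) :=
  quotPerm (fun v => ((1 + 6 * z) * v.1, α * v.2)) (fun v => (α * v.1, (1 + 6 * z) * v.2))
    (compat_smul (sq_mul_eq h27) (sq_mul_inv_eq h27 hα))
    (compat_smul (sq_mul_inv_eq h27 hα) (sq_mul_eq h27))
    (fun v => by
      ext
      · simp only []; linear_combination v.1 * hα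
      · simp only []; linear_combination v.2 * hα)
    (fun v => by
      ext
      · simp only []; linear_combination v.1 * hα
      · simp only []; linear_combination v.2 * hα)

/-- The action of `B⁻¹`. -/
def permD (h27 : 27 * z ^ 3 = 0) {M : ℕ} (hM : ∀ v : R × R, (modelD z)^[M + 1] v = v) :
    Equiv.Perm ((R × R) ⧸ diag z) :=
  quotPerm (modelD z) (modelD z)^[M] (compat_modelD h27) ((compat_modelD h27).iterate M)
    (fun v => by rw [← Function.iterate_succ_apply' (modelD z)]; exact hM v)
    (fun v => by rw [← Function.iterate_succ_apply (modelD z)]; exact hM v)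

theorem quotPerm_pow_apply {f g : R × R → R × R} (hf : Compat z f) (hg : Compat z g)
    (hfg : ∀ v, f (g v) = v) (hgf : ∀ v, g (f v) = v) (k : ℕ) (v : R × R) :
    (quotPerm f g hf hg hfg hgf ^ k) (QuotientAddGroup.mk v) = QuotientAddGroup.mk (f^[k] v) := by
  induction k generalizing v with
  | zero => rfl
  | succ k ih => rw [pow_succ, Equiv.Perm.mul_apply, Function.iterate_succ_apply, ← ih]; rfl

theorem permA_pow_apply (k : ℕ) (v : R × R) :
    (permA z ^ k) (QuotientAddGroup.mk v) = QuotientAddGroup.mk (v + ((k : R), 0)) := by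
  rw [permA, quotPerm_pow_apply]
  congr 1
  induction k with
  | zero => simp
  | succ k ih => rw [Function.iterate_succ_apply', ih]; ext <;> simp [add_assoc]

theorem permC_pow_apply (h27 : 27 * z ^ 3 = 0) {α : R} (hα : α * (1 + 6 * z) = 1) (k : ℕ)
    (v : R × R) : (permC h27 hα ^ k) (QuotientAddGroup.mk v) =
      QuotientAddGroup.mk ((1 + 6 * z) ^ k * v.1, α ^ k * v.2) := by
  rw [permC, quotPerm_pow_apply]
  congr 1
  induction k with
  | zero => simp
  | succ k ih => rw [Function.iterate_succ_apply', ih]; ext <;> simp only [] <;> ring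

/-- This is `b⁻¹ a = a c b⁻¹`, which identifies `permC` as the commutator of the two generators. -/
theorem permD_mul_permA (h27 : 27 * z ^ 3 = 0)
    (h9 : ∀ n : R, 9 * z ^ 3 * (n * (n - 1) * (n - 2)) = 0) {α : ℕ}
    (hα : (α : R) * (1 + 6 * z) = 1) {M : ℕ} (hM : ∀ v : R × R, (modelD z)^[M + 1] v = v) :
    permD h27 hM * permA z = permA z * permC h27 hα * permD h27 hM := by
  ext x
  induction x using Quotient.inductionOn' with
  | h v =>
    refine congrArg QuotientAddGroup.mk (?_ : modelD z (v + (1, 0)) = _ + (1, 0))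
    ext
    · simp only [modelD, Prod.fst_add]
      rw [modelSum_add_one h27 h9]
      ring
    · simp only [modelD, Prod.snd_add, Prod.fst_add, modelExp_add h27, add_zero]
      have : modelExp z 1 = (α : R) := by
        simp only [modelExp]
        linear_combination (-1 + 6 * z - 36 * z ^ 2) * hα + 8 * α * h27
      rw [this]
      ring

theorem permA_mul_permC (h27 : 27 * z ^ 3 = 0) {α : ℕ}
    (hα : (α : R) * (1 + 6 * z) = 1) :
    permA z * permC h27 hα = permC h27 hα * permA z ^ α := by
  ext x
  induction x using Quotient.inductionOn' with
  | h v =>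
    have := permA_pow_apply (z := z) α v
    rw [Equiv.Perm.mul_apply, Equiv.Perm.mul_apply]
    refine Eq.trans ?_ (congrArg (permC h27 hα) this).symm
    refine congrArg QuotientAddGroup.mk (?_ : (((1 + 6 * z) * v.1, α * v.2) : R × R) + (1, 0) =
      ((1 + 6 * z) * (v + ((α : R), (0 : R))).1, (α : R) * (v + ((α : R), (0 : R))).2))
    ext
    · simp only [Prod.fst_add]
      linear_combination -hα
    · simp

theorem permC_mul_permD (h27 : 27 * z ^ 3 = 0)
    (h9 : ∀ n : R, 9 * z ^ 3 * (n * (n - 1) * (n - 2)) = 0) {α : ℕ}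
    (hα : (α : R) * (1 + 6 * z) = 1) {M : ℕ} (hM : ∀ v : R × R, (modelD z)^[M + 1] v = v)
    (hα0 : 0 < α) (h2 : IsUnit (2 : R)) :
    permC h27 hα * permD h27 hM = permD h27 hM ^ α * permC h27 hα := by
  ext x
  induction x using Quotient.inductionOn' with
  | h v =>
    rw [Equiv.Perm.mul_apply, Equiv.Perm.mul_apply]
    refine Eq.trans ?_ (quotPerm_pow_apply _ _ _ _ α ((1 + 6 * z) * v.1, α * v.2)).symm
    exact QuotientAddGroup.eq_iff_sub_mem.2 (iterate_modelD_sub_mem h27 h9 hα0 hα h2 v)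

theorem commR_perm (h27 : 27 * z ^ 3 = 0)
    (h9 : ∀ n : R, 9 * z ^ 3 * (n * (n - 1) * (n - 2)) = 0) {α : ℕ}
    (hα : (α : R) * (1 + 6 * z) = 1) {M : ℕ} (hM : ∀ v : R × R, (modelD z)^[M + 1] v = v) : commR (permA z) (permD h27 hM)⁻¹ = permC h27 hα := by
  rw [commR, inv_inv, mul_assoc _ _ (permA z), permD_mul_permA h27 h9 hα hM]
  group

theorem isMacdonaldPair_perm (h27 : 27 * z ^ 3 = 0)
    (h9 : ∀ n : R, 9 * z ^ 3 * (n * (n - 1) * (n - 2)) = 0) {α : ℕ}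
    (hα : (α : R) * (1 + 6 * z) = 1) {M : ℕ} (hM : ∀ v : R × R, (modelD z)^[M + 1] v = v)
    (hα0 : 0 < α) (h2 : IsUnit (2 : R)) :
    IsMacdonaldPair (α : ℤ) (permA z) (permD h27 hM)⁻¹ := by
  constructor
  · rw [commR_perm h27 h9 hα hM, conjBy, mul_assoc, permA_mul_permC, inv_mul_cancel_left,
      zpow_natCast]
  · have h1 := permC_mul_permD h27 h9 hα hM hα0 h2
    rw [commR_swap, commR_perm h27 h9 hα hM, conjBy, inv_inv, inv_zpow, zpow_natCast,
      eq_inv_iff_mul_eq_one, ← mul_inv_eq_iff_eq_mul.2 h1]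
    group

theorem permD_inv_pow_apply (h27 : 27 * z ^ 3 = 0) {M : ℕ} (hM : ∀ v : R × R, (modelD z)^[M + 1] v = v)
    (j : ℕ) : ((permD h27 hM)⁻¹ ^ j) (QuotientAddGroup.mk (0, 0)) =
    QuotientAddGroup.mk (0, (j : R)) := by
  induction j with
  | zero => simp
  | succ j ih =>
    rw [pow_succ', Equiv.Perm.mul_apply, ih, Equiv.Perm.inv_eq_iff_eq]
    refine congrArg QuotientAddGroup.mk (?_ : _ = modelD z _)
    simp [modelD, modelSum, modelExp]

theorem iterate_modelD_eq_self (h27 : 27 * z ^ 3 = 0)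
    (h9 : ∀ n : R, 9 * z ^ 3 * (n * (n - 1) * (n - 2)) = 0) {k : ℕ} (hk : (k : R) = 0)
    (h2 : IsUnit (2 : R)) (v : R × R) : (modelD z)^[k] v = v := by
  have h3 := two_mul_cast_choose_two R k
  have h4 := two_mul_cast_choose_two R (k + 1)
  have h5 := six_mul_cast_choose_three R (k + 1)
  rw [hk, zero_mul, h2.mul_right_eq_zero] at h3
  push_cast at h4 h5
  rw [hk, zero_add, sub_self, mul_zero, h2.mul_right_eq_zero] at h4
  rw [hk, zero_add, sub_self, mul_zero, zero_mul] at h5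
  rw [iterate_modelD h27 h9, h3, h4, hk]
  ext
  · simp [iterSum]
  · simp only [iterShift, modelExp]
    linear_combination (-6 * z ^ 2 * v.1) * h5

theorem permA_pow_eq_one {k : ℕ} (hk : (k : R) = 0) : permA z ^ k = 1 := by
  ext x
  induction x using Quotient.inductionOn' with
  | h v =>
    refine (permA_pow_apply k v).trans ?_
    rw [hk]
    simp only [Prod.mk_zero_zero, add_zero]
    rfl

theorem permD_pow_eq_one (h27 : 27 * z ^ 3 = 0) {M : ℕ}
    (hM : ∀ v : R × R, (modelD z)^[M + 1] v = v) : permD h27 hM ^ (M + 1) = 1 := by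
  ext x
  induction x using Quotient.inductionOn' with
  | h v => exact (quotPerm_pow_apply _ _ _ _ (M + 1) v).trans (congrArg QuotientAddGroup.mk (hM v))

/-- Applied to the class of the origin, the power of `c` does nothing, the power of `b` gives `(0,
j)` and the power of `a` gives `(i, j)`. -/
theorem exists_of_pow_mul_pow_mul_pow_eq_one (h27 : 27 * z ^ 3 = 0)
    (h9 : ∀ n : R, 9 * z ^ 3 * (n * (n - 1) * (n - 2)) = 0) {α : ℕ}
    (hα : (α : R) * (1 + 6 * z) = 1) {M : ℕ} (hM : ∀ v : R × R, (modelD z)^[M + 1] v = v)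
    {i j k : ℕ} (h : permA z ^ i * (permD h27 hM)⁻¹ ^ j *
      commR (permA z) (permD h27 hM)⁻¹ ^ k = 1) :
    ∃ r, 9 * z ^ 2 * r = (i : R) ∧ 9 * z ^ 2 * r = (j : R) := by
  have h1 := congrArg (fun f : Equiv.Perm ((R × R) ⧸ diag z) => f (QuotientAddGroup.mk (0, 0))) h
  rw [commR_perm h27 h9 hα hM] at h1
  simp only [Equiv.Perm.mul_apply] at h1
  rw [permC_pow_apply, mul_zero, mul_zero, permD_inv_pow_apply, permA_pow_apply, Equiv.Perm.one_apply,
    QuotientAddGroup.eq_iff_sub_mem, mem_diag] at h1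
  simpa using h1

/-- Applied to `(1, 0)`, the power of `c` changes only the first coordinate. A diagonal element with
second coordinate `0` is `0`, so `(1 + 6 z) ^ k = 1`. -/
theorem pow_eq_one_of_commR_pow_eq_one (h27 : 27 * z ^ 3 = 0)
    (h9 : ∀ n : R, 9 * z ^ 3 * (n * (n - 1) * (n - 2)) = 0) {α : ℕ}
    (hα : (α : R) * (1 + 6 * z) = 1) {M : ℕ} (hM : ∀ v : R × R, (modelD z)^[M + 1] v = v)
    {k : ℕ} (h : commR (permA z) (permD h27 hM)⁻¹ ^ k = 1) : (α : R) ^ k = 1 := by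
  have h1 := congrArg (fun f : Equiv.Perm ((R × R) ⧸ diag z) => f (QuotientAddGroup.mk (1, 0))) h
  rw [commR_perm h27 h9 hα hM] at h1
  rw [permC_pow_apply, mul_one, mul_zero, Equiv.Perm.one_apply,
    QuotientAddGroup.eq_iff_sub_mem, mem_diag] at h1
  obtain ⟨r, hr1, hr2⟩ := h1
  simp only [Prod.fst_sub, Prod.snd_sub, sub_zero] at hr1 hr2
  rw [hr2, eq_comm, sub_eq_zero] at hr1
  have h3 : ((α : R) * (1 + 6 * z)) ^ k = 1 := by rw [hα, one_pow]
  rwa [mul_pow, hr1, mul_one] at h3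

end MacdonaldModel

/-! ### The model over `ZMod (p ^ (3 * m))`. -/

/-- The equations give `α * (1 + 6 * z) ≡ 1` and `27 * z ^ 3 ≡ 0` modulo `p ^ (3 * m)`. For `p = 3`
the division by `3` is taken out of `p ^ m`, otherwise out of `y`. -/
theorem exists_int_model_parameter {p m : ℕ} (hp : p.Prime) (hp2 : p ≠ 2) (hm : 0 < m) {α : ℕ}
    {u : ℤ} (hα : (α : ℤ) = 1 + p ^ m * u) :
    ∃ z y w : ℤ, 3 * z = p ^ m * y ∧ 2 * α * y = -u + p ^ (3 * m) * w := by
  have hpα : IsCoprime (α : ℤ) (p ^ (3 * m) : ℤ) := by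
    refine IsCoprime.pow_right ⟨1, -(p ^ (m - 1) * u), ?_⟩
    have : (p : ℤ) ^ m = p ^ (m - 1) * p := by rw [← pow_succ, Nat.sub_add_cancel hm]
    rw [hα, this]
    ring
  have h2 : IsCoprime (2 : ℤ) (p ^ (3 * m) : ℤ) := by
    refine IsCoprime.pow_right ?_
    exact_mod_cast Nat.isCoprime_iff_coprime.2 ((Nat.coprime_primes Nat.prime_two hp).2 hp2.symm)
  by_cases hp3 : p = 3
  · subst hp3
    obtain ⟨r, s, hrs⟩ := h2.mul_left hpα
    refine ⟨3 ^ (m - 1) * (-u * r), -u * r, u * s, ?_, ?_⟩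
    · have : (3 : ℤ) ^ m = 3 ^ (m - 1) * 3 := by rw [← pow_succ, Nat.sub_add_cancel hm]
      push_cast
      rw [this]
      ring
    · push_cast at hrs ⊢
      linear_combination (-u) * hrs
  · have h3 : IsCoprime (3 : ℤ) (p ^ (3 * m) : ℤ) := by
      refine IsCoprime.pow_right ?_
      exact_mod_cast Nat.isCoprime_iff_coprime.2
        ((Nat.coprime_primes Nat.prime_three hp).2 (Ne.symm hp3))
    obtain ⟨r, s, hrs⟩ := (h2.mul_left hpα).mul_left h3
    refine ⟨p ^ m * (-u * r), 3 * (-u * r), u * s, by ring, ?_⟩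
    linear_combination (-u) * hrs

theorem Int.three_dvd_mul_mul (n : ℤ) : (3 : ℤ) ∣ n * (n - 1) * (n - 2) := by
  have : n % 3 = 0 ∨ n % 3 = 1 ∨ n % 3 = 2 := by omega
  rcases this with h | h | h
  · exact Dvd.dvd.mul_right (Dvd.dvd.mul_right (by omega) _) _
  · exact Dvd.dvd.mul_right (Dvd.dvd.mul_left (by omega) _) _
  · exact Dvd.dvd.mul_left (by omega) _

/-- A `p`-group quotient of the Macdonald group in which words `a ^ i * b ^ j * c ^ k` are
sufficiently independent. -/
theorem exists_macdonald_model {p m : ℕ} (hp : p.Prime) (hp2 : p ≠ 2) (hm : 0 < m) {α : ℕ}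
    (hα0 : 0 < α) {u : ℤ} (hα : (α : ℤ) = 1 + p ^ m * u) :
    ∃ (H : Type) (_ : Group H) (a b : H), IsMacdonaldPair (α : ℤ) a b ∧
      IsPGroup p H ∧ a ^ p ^ (3 * m) = 1 ∧ b ^ p ^ (3 * m) = 1 ∧
      (∀ i j k : ℕ, a ^ i * b ^ j * commR a b ^ k = 1 →
        p ^ (2 * m) ∣ j ∧ i ≡ j [MOD p ^ (3 * m)]) ∧
      ∀ k : ℕ, commR a b ^ k = 1 → p ^ (3 * m) ∣ α ^ k - 1 := by
  have : Fact p.Prime := ⟨hp⟩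
  obtain ⟨z, y, w, hz, hy⟩ := exists_int_model_parameter hp hp2 hm hα
  obtain ⟨q, hqp⟩ : ∃ q, q = p ^ (3 * m) := ⟨_, rfl⟩
  have hq : (q : ZMod q) = 0 := ZMod.natCast_self _
  have hq' : ((p : ZMod q)) ^ (3 * m) = 0 := by
    exact_mod_cast (ZMod.natCast_eq_zero_iff (p ^ (3 * m)) q).2 (hqp ▸ dvd_rfl)
  have hpm : ((p : ℤ) ^ m) ^ 3 = p ^ (3 * m) := by rw [← pow_mul, mul_comm]
  have h27 : 27 * (z : ZMod q) ^ 3 = 0 := by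
    have : (27 * z ^ 3 : ℤ) = p ^ (3 * m) * y ^ 3 := by
      rw [← hpm]
      linear_combination ((3 * z) ^ 2 + 3 * z * (p ^ m * y) + (p ^ m * y) ^ 2) * hz
    have := congrArg (Int.cast : ℤ → ZMod q) this
    push_cast at this
    rw [this, hq', zero_mul]
  have h9 : ∀ n : ZMod q, 9 * (z : ZMod q) ^ 3 * (n * (n - 1) * (n - 2)) = 0 := by
    intro n
    obtain ⟨N, rfl⟩ := ZMod.intCast_surjective n
    obtain ⟨t, ht⟩ := Int.three_dvd_mul_mul N
    have := congrArg (Int.cast : ℤ → ZMod q) ht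
    push_cast at this
    rw [this]
    linear_combination (t : ZMod q) * h27
  have hαz : (α : ZMod q) * (1 + 6 * (z : ZMod q)) = 1 := by
    have : (α : ℤ) * (1 + 6 * z) = 1 + p ^ (3 * m) * (p ^ m * w) := by
      linear_combination 2 * α * hz + p ^ m * hy + hα
    have := congrArg (Int.cast : ℤ → ZMod q) this
    push_cast at this
    rw [this, hq', zero_mul, add_zero]
  have h2 : IsUnit (2 : ZMod q) := by
    have : IsUnit ((2 : ℕ) : ZMod q) := by
      rw [ZMod.isUnit_iff_coprime, hqp]
      exact Nat.Coprime.pow_right _ ((Nat.coprime_primes Nat.prime_two hp).2 hp2.symm)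
    exact_mod_cast this
  obtain ⟨M, hMq⟩ : ∃ M, q = M + 1 :=
    ⟨q - 1, (Nat.sub_add_cancel (hqp ▸ Nat.one_le_pow _ _ hp.pos)).symm⟩
  have hM : ∀ v : ZMod q × ZMod q, (MacdonaldModel.modelD (z : ZMod q))^[M + 1] v = v :=
    MacdonaldModel.iterate_modelD_eq_self h27 h9 (by rw [← hMq]; exact hq) h2
  have hpair := MacdonaldModel.isMacdonaldPair_perm h27 h9 hαz hM hα0 h2
  set A := MacdonaldModel.permA (z : ZMod q) with hA
  set B := (MacdonaldModel.permD h27 hM)⁻¹ with hB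
  have hA1 : A ^ q = 1 := MacdonaldModel.permA_pow_eq_one hq
  have hB1 : B ^ q = 1 := by
    rw [congrArg (B ^ ·) hMq, hB, inv_pow, MacdonaldModel.permD_pow_eq_one h27 hM, inv_one]
  -- Passing to the subgroup generated by the pair makes the nilpotency theorem applicable, so that
  -- the model is a `p`-group.
  let K := Subgroup.closure {A, B}
  let a : K := ⟨A, Subgroup.subset_closure (by simp)⟩
  let b : K := ⟨B, Subgroup.subset_closure (by simp)⟩
  have ha1 : a ^ q = 1 := Subtype.ext hA1
  have hb1 : b ^ q = 1 := Subtype.ext hB1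
  have hab : Subgroup.closure {a, b} = ⊤ := by
    have h1 := Subgroup.closure_closure_coe_preimage (k := ({A, B} : Set _))
    convert h1 using 2
    ext x
    simp [a, b, Subtype.ext_iff]
  have hpair' : IsMacdonaldPair (α : ℤ) a b :=
    ⟨Subtype.ext hpair.conj_left, Subtype.ext hpair.conj_right⟩
  have hcK : ((commR a b : K) : Equiv.Perm _) = commR A B := rfl
  obtain ⟨hnil, hfin⟩ := hpair'.isNilpotent_and_finite q (hqp ▸ pow_ne_zero _ hp.ne_zero)
    (fun r hr hrp => by
      rw [hqp] at hrp
      rw [(Nat.prime_dvd_prime_iff_eq hr hp).1 (hr.dvd_of_dvd_pow hrp), hα, add_sub_cancel_left]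
      exact (dvd_pow_self _ hm.ne').mul_right _) hab ha1 hb1
  subst hqp
  refine ⟨K, inferInstance, a, b, hpair', isPGroup_of_closure_pair hab ha1 hb1, ha1, hb1, ?_, ?_⟩
  · intro i j k h
    have h1 : A ^ i * B ^ j * commR A B ^ k = 1 := congrArg Subtype.val h
    obtain ⟨r, hr1, hr2⟩ := MacdonaldModel.exists_of_pow_mul_pow_mul_pow_eq_one h27 h9 hαz hM h1
    constructor
    · obtain ⟨r, rfl⟩ := ZMod.intCast_surjective r
      have h3 : (p : ℤ) ^ (3 * m) ∣ 9 * z ^ 2 * r - j := by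
        have := (ZMod.intCast_zmod_eq_zero_iff_dvd (9 * z ^ 2 * r - j) (p ^ (3 * m))).1
          (by push_cast; exact sub_eq_zero.2 hr2)
        exact_mod_cast this
      have h4 : (p : ℤ) ^ (2 * m) ∣ 9 * z ^ 2 * r := by
        refine ⟨y ^ 2 * r, ?_⟩
        rw [mul_comm 2 m, pow_mul]
        linear_combination (3 * z + p ^ m * y) * r * hz
      have h5 := (dvd_sub_right h4).1 ((pow_dvd_pow _ (by omega)).trans h3)
      exact_mod_cast h5
    · exact (ZMod.natCast_eq_natCast_iff _ _ _).1 (hr1.symm.trans hr2)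
  · intro k h
    have h1 : commR A B ^ k = 1 := congrArg Subtype.val h
    have h2 := MacdonaldModel.pow_eq_one_of_commR_pow_eq_one h27 h9 hαz hM h1
    have h3 : 1 ≤ α ^ k := Nat.one_le_pow _ _ hα0
    rw [← ZMod.natCast_eq_zero_iff, Nat.cast_sub h3]
    push_cast
    rw [h2, sub_self]

/-! ### Expansions of geometric sums. -/

theorem exists_geomSum_eq (μ : ℤ) (n : ℕ) : ∃ t, geomSum (1 + μ) n =
    n + n.choose 2 * μ + n.choose 3 * μ ^ 2 + μ ^ 3 * t := by
  have h1 : ∀ i : ℕ, ∃ t, (1 + μ) ^ i = 1 + i * μ + i.choose 2 * μ ^ 2 + μ ^ 3 * t := by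
    intro i
    induction i with
    | zero => exact ⟨0, by simp⟩
    | succ i ih =>
      obtain ⟨t, ht⟩ := ih
      refine ⟨t * (1 + μ) + i.choose 2, ?_⟩
      rw [pow_succ, ht, Nat.choose_succ_succ' i 1, Nat.choose_one_right]
      push_cast
      ring
  induction n with
  | zero => exact ⟨0, by simp [geomSum]⟩
  | succ n ih =>
    obtain ⟨t, ht⟩ := ih
    obtain ⟨t', ht'⟩ := h1 n
    refine ⟨t + t', ?_⟩
    rw [geomSum_succ, ht, ht', Nat.choose_succ_succ' n 1, Nat.choose_succ_succ' n 2,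
      Nat.choose_one_right]
    push_cast
    ring

/-- Oddness makes `q.choose 2` a multiple of `q`, so the linear term of the expansion vanishes
modulo `q ^ 2`. -/
theorem exists_geomSum_eq_of_odd {q : ℕ} (hq : Odd q) {α u : ℤ} (hα : α = 1 + q * u) :
    ∃ t, geomSum α q = q + q ^ 2 * t := by
  obtain ⟨t, ht⟩ := exists_geomSum_eq (q * u) q
  obtain ⟨r, hr⟩ := hq
  have h1 := two_mul_cast_choose_two ℤ q
  have h2 : ((q.choose 2 : ℕ) : ℤ) = q * r := by
    have : (q : ℤ) - 1 = 2 * r := by rw [hr]; push_cast; ring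
    rw [this] at h1
    linarith
  refine ⟨r * u + q.choose 3 * u ^ 2 + q * u ^ 3 * t, ?_⟩
  rw [hα, ht, h2]
  ring

theorem exists_mul_geomSum_eq {q : ℕ} (hq : Odd q) {α u : ℤ} (hα : α = 1 + q * u) :
    ∃ t, α * geomSum α q = q + q ^ 2 * t := by
  obtain ⟨t, ht⟩ := exists_geomSum_eq_of_odd hq hα
  refine ⟨t + u + q * u * t, ?_⟩
  rw [ht, hα]
  ring

theorem exists_pow_eq_of_odd {q : ℕ} (hq : Odd q) {α u : ℤ} (hα : α = 1 + q * u) :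
    ∃ t, α ^ q = 1 + q ^ 2 * t := by
  obtain ⟨t, ht⟩ := exists_geomSum_eq_of_odd hq hα
  have h1 := geomSum_mul α q
  refine ⟨u + q * u * t, ?_⟩
  rw [ht] at h1
  rw [← sub_eq_iff_eq_add', ← h1, hα]
  ring

/-! ### Consequences of the core relations. -/

/-- The relations that hold in the Sylow subgroup, with `q = p ^ m`. -/
structure MacdonaldCore {T : Type*} [Group T] (q : ℕ) (α : ℤ) (a b : T) : Prop where
  pair : IsMacdonaldPair α a b
  closure_eq : Subgroup.closure {a, b} = ⊤
  odd : Odd q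
  exists_eq : ∃ u, α = 1 + q * u
  left_pow : a ^ q ^ 3 = 1
  mul_pow : a ^ q ^ 2 * b ^ q ^ 2 = 1
  left_mem_center : a ^ q ^ 2 ∈ Subgroup.center T

theorem mul_pow_of_commutator_central {T : Type*} [Group T] {x y t : T} (h : y * x = x * y * t)
    (ht : ∀ g, Commute t g) (n : ℕ) : (x * y) ^ n = x ^ n * y ^ n * t ^ n.choose 2 := by
  have h1 : ∀ n, y ^ n * x = x * y ^ n * t ^ n := by
    intro n
    induction n with
    | zero => simp
    | succ n ih =>
      rw [pow_succ, mul_assoc, h, mul_assoc x y t, ← mul_assoc, ih]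
      simp only [mul_assoc]
      congr 2
      rw [← mul_assoc, ((ht _).pow_left n).eq, mul_assoc, pow_succ]
  induction n with
  | zero => simp
  | succ n ih =>
    rw [pow_succ, ih, Nat.choose_succ_succ' n 1, Nat.choose_one_right]
    calc x ^ n * y ^ n * t ^ n.choose 2 * (x * y)
        = x ^ n * (y ^ n * x) * y * t ^ n.choose 2 := by
          rw [mul_assoc, ((ht _).pow_left _).eq]; group
      _ = x ^ n * (x * y ^ n * (t ^ n * y)) * t ^ n.choose 2 := by rw [h1]; group
      _ = x ^ n * (x * y ^ n * (y * t ^ n)) * t ^ n.choose 2 := by rw [((ht y).pow_left n).eq]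
      _ = _ := by rw [pow_succ, pow_succ, pow_add]; group

namespace MacdonaldCore

variable {T : Type*} [Group T] {q : ℕ} {α : ℤ} {a b : T}

theorem commute_left (h : MacdonaldCore q α a b) (x : T) : Commute (a ^ q ^ 2) x :=
  (Subgroup.mem_center_iff.1 h.left_mem_center x).symm

theorem right_eq (h : MacdonaldCore q α a b) : b ^ q ^ 2 = (a ^ q ^ 2)⁻¹ :=
  eq_inv_of_mul_eq_one_right h.mul_pow

theorem right_pow (h : MacdonaldCore q α a b) : b ^ q ^ 3 = 1 := by
  have h1 : q ^ 3 = q ^ 2 * q := by ring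
  rw [h1, pow_mul, h.right_eq, inv_pow, ← pow_mul, ← h1, h.left_pow, inv_one]

theorem swap (h : MacdonaldCore q α a b) : MacdonaldCore q α b a where
  pair := h.pair.swap
  closure_eq := by rw [Set.pair_comm, h.closure_eq]
  odd := h.odd
  exists_eq := h.exists_eq
  left_pow := h.right_pow
  mul_pow := by rw [h.right_eq, inv_mul_cancel]
  left_mem_center := by
    rw [h.right_eq]
    exact inv_mem h.left_mem_center

theorem zpow_pow (h : MacdonaldCore q α a b) (w : ℤ) : a ^ ((q : ℤ) ^ 3 * w) = 1 := by
  rw [zpow_mul]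
  have : a ^ ((q : ℤ) ^ 3) = 1 := by exact_mod_cast h.left_pow
  rw [this, one_zpow]

theorem zpow_sq (a : T) (w : ℤ) : a ^ ((q : ℤ) ^ 2 * w) = (a ^ q ^ 2) ^ w := by
  rw [zpow_mul]
  congr 1
  exact_mod_cast rfl

theorem zpow_center_pow (h : MacdonaldCore q α a b) (w : ℤ) : (a ^ q ^ 2) ^ (q * w) = 1 := by
  rw [← zpow_sq, ← mul_assoc, show (q : ℤ) ^ 2 * q = q ^ 3 by ring, h.zpow_pow]

/-- Conjugation by `c ^ q` raises `a` to the power `α ^ q ≡ 1` modulo `q ^ 2`, which is invisible on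
`a ^ q` because `a ^ q ^ 3 = 1`. -/
theorem commute_left_pow_commR (h : MacdonaldCore q α a b) :
    Commute (a ^ (q : ℤ)) (commR a b ^ q) := by
  obtain ⟨u, hu⟩ := h.exists_eq
  obtain ⟨t, ht⟩ := exists_pow_eq_of_odd h.odd hu
  have h1 := h.pair.zpow_mul_commR_pow q q
  rw [ht, mul_add, mul_one, zpow_add, show (q : ℤ) * (q ^ 2 * t) = q ^ 3 * t by ring, h.zpow_pow,
    mul_one] at h1
  exact h1

theorem commute_right_pow_commR (h : MacdonaldCore q α a b) :
    Commute (b ^ (q : ℤ)) (commR a b ^ q) := by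
  have := h.swap.commute_left_pow_commR
  rwa [commR_swap, inv_pow, Commute.inv_right_iff] at this

theorem exists_left_mul_commR (h : MacdonaldCore q α a b) :
    ∃ w : ℤ, a * commR a b ^ q = commR a b ^ q * a * (a ^ q ^ 2) ^ w := by
  obtain ⟨u, hu⟩ := h.exists_eq
  obtain ⟨t, ht⟩ := exists_pow_eq_of_odd h.odd hu
  have h1 := h.pair.zpow_mul_commR_pow 1 q
  rw [ht, one_mul, zpow_add, zpow_one, zpow_sq, ← mul_assoc] at h1
  exact ⟨t, h1⟩

theorem exists_conj_pow (h : MacdonaldCore q α a b) :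
    ∃ w : ℤ, b⁻¹ * a ^ q * b = commR a b ^ q * a ^ q * (a ^ q ^ 2) ^ w := by
  obtain ⟨u, hu⟩ := h.exists_eq
  obtain ⟨t, ht⟩ := exists_mul_geomSum_eq h.odd hu
  have h1 := h.pair.conj_pow q
  rw [ht, zpow_add, zpow_natCast, zpow_sq, ← mul_assoc] at h1
  exact ⟨t, h1⟩

/-- The `q`-th power of `b⁻¹ a ^ q b = c ^ q a ^ q z ^ w`, with `z = a ^ q ^ 2`, equates the central
`z` with `c ^ q ^ 2 * z`. -/
theorem commR_pow (h : MacdonaldCore q α a b) : commR a b ^ q ^ 2 = 1 := by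
  obtain ⟨w, hw⟩ := h.exists_conj_pow
  have h1 := _root_.conj_pow (a := b⁻¹) (b := a ^ q) (i := q)
  rw [inv_inv, hw, ((h.commute_left _).zpow_left w).symm.mul_pow] at h1
  have h2 := h.commute_left_pow_commR
  rw [zpow_natCast] at h2
  have h3 : ((a ^ q ^ 2) ^ w) ^ q = 1 := by
    rw [← zpow_natCast, ← zpow_mul, mul_comm, h.zpow_center_pow]
  rw [h3, mul_one, h2.symm.mul_pow, ← pow_mul, ← pow_mul, ← sq, mul_assoc, (h.commute_left b).eq,
    inv_mul_cancel_left, mul_eq_right] at h1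
  exact h1

theorem _root_.conj_zpow_of_commute {x d g : T} (h : x⁻¹ * g * x = g * d) (hd : Commute x d)
    (j : ℤ) : (x ^ j)⁻¹ * g * x ^ j = g * d ^ j := by
  have h1 : g⁻¹ * x⁻¹ * g = d * x⁻¹ := by
    rw [eq_mul_inv_iff_mul_eq, mul_assoc, mul_assoc, inv_mul_eq_iff_eq_mul, ← h, mul_assoc]
  have h2 := conj_zpow (a := g⁻¹) (b := x⁻¹) (i := j)
  rw [inv_inv, h1, (hd.symm.inv_right).mul_zpow, inv_zpow] at h2
  rw [← inv_mul_eq_iff_eq_mul, ← mul_assoc, ← mul_assoc, ← h2, inv_mul_cancel_right]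

theorem zpow_commR (k : ℤ) : (commR a b ^ q) ^ k = commR a b ^ (q * k) := by
  rw [zpow_mul, zpow_natCast]

/-- Conjugating `a` by a power of `b ^ q`. -/
theorem exists_conj_left (h : MacdonaldCore q α a b) :
    ∃ w : ℤ, ∀ j : ℤ, (b ^ (q * j))⁻¹ * a * b ^ (q * j) =
      a * commR a b ^ (q * j) * (a ^ q ^ 2) ^ (w * j) := by
  obtain ⟨w, hw⟩ := h.swap.exists_conj_pow
  rw [commR_swap, inv_pow, h.right_eq, inv_zpow'] at hw
  set z := a ^ q ^ 2 with hz
  have hzc : ∀ (x : T) (n : ℤ), Commute (z ^ n) x := fun x n => (h.commute_left x).zpow_left n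
  have hbc : Commute (b ^ q) (commR a b ^ q) := by
    simpa using h.commute_right_pow_commR
  refine ⟨w, fun j => ?_⟩
  have h1 : (b ^ q)⁻¹ * a * b ^ q = a * (commR a b ^ q * z ^ w) := by
    have h2 : (b ^ q)⁻¹ * a * b ^ q = a * ((a⁻¹ * b ^ q * a)⁻¹ * b ^ q) := by group
    rw [h2, hw, mul_inv_rev, mul_inv_rev, zpow_neg, inv_inv, inv_inv, mul_assoc, mul_assoc,
      ← hbc.eq, inv_mul_cancel_left, (hzc _ w).eq]
  have h3 := conj_zpow_of_commute h1 (hbc.mul_right (hzc _ w).symm) j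
  rw [(hzc _ w).symm.mul_zpow, ← zpow_natCast, ← zpow_mul, zpow_commR, ← zpow_mul, ← mul_assoc] at h3
  exact h3

theorem exists_pow_mul_zpow (h : MacdonaldCore q α a b) (i : ℕ) (s : ℤ) :
    ∃ t : ℤ, commR a b ^ i * a ^ s = a ^ t * commR a b ^ i := by
  have hq : 1 ≤ q ^ 2 := Nat.one_le_pow _ _ h.odd.pos
  have h1 := h.pair.zpow_mul_commR_pow s ((q ^ 2 - 1) * i)
  -- Since `c ^ q ^ 2 = 1`, inverses of powers of `c` are natural powers, so the commutation formula
  -- also moves `c` to the right.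
  have h2 : commR a b ^ ((q ^ 2 - 1) * i) = (commR a b ^ i)⁻¹ := by
    rw [eq_inv_iff_mul_eq_one, ← pow_add, ← add_one_mul, Nat.sub_add_cancel hq, pow_mul,
      h.commR_pow, one_pow]
  rw [h2] at h1
  refine ⟨s * α ^ ((q ^ 2 - 1) * i), ?_⟩
  calc commR a b ^ i * a ^ s
      = commR a b ^ i * (a ^ s * (commR a b ^ i)⁻¹) * commR a b ^ i := by group
    _ = _ := by rw [h1, mul_inv_cancel_left]

/-- `conj_pow` describes `b⁻¹ * a ^ n` for natural `n` only, so the exponent of `a` is reduced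
modulo `q ^ 3` beforehand. -/
theorem exists_inv_right_mul (h : MacdonaldCore q α a b) {x : T}
    (hx : ∃ (i j : ℤ) (k : ℕ), x = a ^ i * b ^ j * commR a b ^ k) :
    ∃ (i j : ℤ) (k : ℕ), b⁻¹ * x = a ^ i * b ^ j * commR a b ^ k := by
  obtain ⟨i, j, k, rfl⟩ := hx
  have hq : (q : ℤ) ^ 3 ≠ 0 := pow_ne_zero _ (by exact_mod_cast h.odd.pos.ne')
  obtain ⟨n, hn⟩ : ∃ n : ℕ, a ^ i = a ^ n := by
    obtain ⟨n, hn⟩ := Int.eq_ofNat_of_zero_le (Int.emod_nonneg i hq)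
    refine ⟨n, ?_⟩
    conv_lhs => rw [← Int.emod_add_mul_ediv i (q ^ 3), zpow_add, h.zpow_pow, mul_one, hn,
      zpow_natCast]
  obtain ⟨t, ht⟩ := h.exists_pow_mul_zpow n (α * geomSum α n)
  refine ⟨t, (j - 1) * α ^ n, n + k, ?_⟩
  have h1 : b⁻¹ * a ^ n = commR a b ^ n * a ^ (α * geomSum α n) * b⁻¹ := by
    rw [← h.pair.conj_pow, mul_inv_cancel_right]
  have h2 := h.pair.commR_pow_mul_zpow (j - 1) n
  calc b⁻¹ * (a ^ i * b ^ j * commR a b ^ k)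
      = (b⁻¹ * a ^ n) * (b ^ j * commR a b ^ k) := by rw [hn]; group
    _ = a ^ t * (commR a b ^ n * b ^ (j - 1)) * commR a b ^ k := by
        rw [h1, ht, sub_eq_neg_add, zpow_add, zpow_neg_one]; group
    _ = _ := by rw [h2, pow_add]; group

/-- Every element is a product of powers of `a`, `b` and their commutator. -/
theorem exists_eq_mul (h : MacdonaldCore q α a b) (x : T) :
    ∃ (i j : ℤ) (k : ℕ), x = a ^ i * b ^ j * commR a b ^ k := by
  have hx : x ∈ Subgroup.closure {a, b} := h.closure_eq ▸ Subgroup.mem_top x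
  have hpow : ∀ n (y : T), (∃ (i j : ℤ) (k : ℕ), y = a ^ i * b ^ j * commR a b ^ k) →
      ∃ (i j : ℤ) (k : ℕ), b⁻¹ ^ n * y = a ^ i * b ^ j * commR a b ^ k := by
    intro n
    induction n with
    | zero => simp
    | succ n ih =>
      intro y hy
      rw [pow_succ', mul_assoc]
      exact h.exists_inv_right_mul (ih y hy)
  induction hx using Subgroup.closure_induction_left with
  | one => exact ⟨0, 0, 0, by simp⟩
  | mul_left y hy g _ ih =>
    rcases hy with rfl | hy
    · obtain ⟨i, j, k, rfl⟩ := ih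
      exact ⟨i + 1, j, k, by rw [add_comm, zpow_one_add]; group⟩
    · have hy : y = b := hy
      -- Left multiplication by `b` is an iterate of left multiplication by `b⁻¹`.
      have h1 : b⁻¹ ^ (q ^ 3 - 1) = b := by
        rw [inv_pow, inv_eq_iff_mul_eq_one, ← pow_succ,
          Nat.sub_add_cancel (Nat.one_le_pow _ _ h.odd.pos), h.right_pow]
      have := hpow (q ^ 3 - 1) g ih
      rw [h1] at this
      rwa [hy]
  | inv_mul_cancel y hy g _ ih =>
    rcases hy with rfl | hy
    · obtain ⟨i, j, k, rfl⟩ := ih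
      exact ⟨i - 1, j, k, by rw [sub_eq_neg_add, zpow_add]; group⟩
    · have hy : y = b := hy
      rw [hy]
      exact h.exists_inv_right_mul ih

end MacdonaldCore

/-! ### The Heisenberg group and the upper central series. -/

section Heisenberg

variable {R : Type*} [CommRing R]

/-- The unitriangular matrix with entries `x`, `y` above the diagonal and `z` in the corner. -/
def heisMk (x y z : R) : Heis R :=
  ⟨⟨!![1, x, z; 0, 1, y; 0, 0, 1], by simp [Matrix.det_fin_three]⟩, by
    refine ⟨fun i => ?_, fun i j h => ?_⟩
    · fin_cases i <;> simp
    · fin_cases i <;> fin_cases j <;> simp at h ⊢⟩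

theorem heisMk_inj {x y z x' y' z' : R} :
    heisMk x y z = heisMk x' y' z' ↔ x = x' ∧ y = y' ∧ z = z' := by
  constructor
  · intro h
    have h1 : (heisMk x y z).1.1 = (heisMk x' y' z').1.1 := by rw [h]
    have h2 := congrFun (congrFun h1 0) 1
    have h3 := congrFun (congrFun h1 1) 2
    have h4 := congrFun (congrFun h1 0) 2
    simp only [heisMk] at h2 h3 h4
    exact ⟨by simpa using h2, by simpa using h3, by simpa using h4⟩
  · rintro ⟨rfl, rfl, rfl⟩
    rfl

theorem exists_eq_heisMk (M : Heis R) : ∃ x y z, M = heisMk x y z := by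
  obtain ⟨⟨M, hM⟩, h1, h2⟩ := M
  refine ⟨M 0 1, M 1 2, M 0 2, ?_⟩
  have a1 := h2 1 0 (by decide)
  have a2 := h2 2 0 (by decide)
  have a3 := h2 2 1 (by decide)
  simp only at h1 a1 a2 a3
  apply Subtype.ext
  apply Subtype.ext
  ext i j
  fin_cases i <;> fin_cases j <;> simp [heisMk, h1, a1, a2, a3]

theorem heisMk_mul (x y z x' y' z' : R) :
    heisMk x y z * heisMk x' y' z' = heisMk (x + x') (y + y') (z + z' + x * y') := by
  apply Subtype.ext
  apply Subtype.ext
  change !![1, x, z; 0, 1, y; 0, 0, 1] * !![1, x', z'; 0, 1, y'; 0, 0, 1] =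
    !![1, x + x', z + z' + x * y'; 0, 1, y + y'; 0, 0, 1]
  ext i j
  fin_cases i <;> fin_cases j <;> simp [Matrix.mul_apply, Fin.sum_univ_three] <;> ring

theorem heisMk_zero : heisMk (0 : R) 0 0 = 1 := by
  have := heisMk_mul (0 : R) 0 0 0 0 0
  simpa using this

theorem heisMk_pow (x y z : R) (n : ℕ) :
    heisMk x y z ^ n = heisMk (n * x) (n * y) (n * z + n.choose 2 * (x * y)) := by
  induction n with
  | zero => simp [heisMk_zero]
  | succ n ih =>
    rw [pow_succ, ih, heisMk_mul, Nat.choose_succ_succ' n 1, Nat.choose_one_right, heisMk_inj]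
    push_cast
    exact ⟨by ring, by ring, by ring⟩

theorem commR_heisMk : commR (heisMk (1 : R) 0 0) (heisMk 0 1 0) = heisMk 0 0 1 := by
  rw [commR, mul_assoc, ← mul_inv_rev, inv_mul_eq_iff_eq_mul]
  simp only [heisMk_mul, heisMk_inj]
  simp

theorem heis_pow_eq_one {q : ℕ} (hq : Odd q) (M : Heis (ZMod q)) : M ^ q = 1 := by
  obtain ⟨x, y, z, rfl⟩ := exists_eq_heisMk M
  obtain ⟨r, hr⟩ := hq
  have h1 : q.choose 2 = q * r := by
    rw [Nat.choose_two_right, show q - 1 = r * 2 by omega, ← mul_assoc, Nat.mul_div_cancel _ two_pos]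
  rw [heisMk_pow, h1, ← heisMk_zero, heisMk_inj]
  simp

theorem isMacdonaldPair_heisMk {q : ℕ} (hq : Odd q) {α u : ℤ} (hα : α = 1 + q * u) :
    IsMacdonaldPair α (heisMk (1 : ZMod q) 0 0) (heisMk 0 1 0) := by
  have h1 : ∀ M : Heis (ZMod q), M ^ α = M := fun M => by
    rw [hα, zpow_add, zpow_one, zpow_mul, zpow_natCast, heis_pow_eq_one hq, one_zpow, mul_one]
  constructor
  · rw [h1, commR_heisMk, conjBy, mul_assoc, inv_mul_eq_iff_eq_mul]
    simp only [heisMk_mul, heisMk_inj]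
    simp
  · rw [h1, commR_swap, commR_heisMk, conjBy, inv_inv, mul_inv_eq_iff_eq_mul]
    simp only [heisMk_mul, heisMk_inj]
    simp

end Heisenberg

/-- Modulo the `n`-th term the condition is centrality, which may be tested on generators. -/
theorem mem_upperCentralSeries_succ_iff_of_closure {T : Type*} [Group T] {a b : T}
    (hab : Subgroup.closure {a, b} = ⊤) {n : ℕ} {x : T} :
    x ∈ Subgroup.upperCentralSeries T (n + 1) ↔
      a⁻¹ * (x⁻¹ * a * x) ∈ Subgroup.upperCentralSeries T n ∧
        b⁻¹ * (x⁻¹ * b * x) ∈ Subgroup.upperCentralSeries T n := by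
  set H := Subgroup.upperCentralSeries T n with hH
  let f := QuotientGroup.mk' H
  have key : ∀ y : T, y⁻¹ * (x⁻¹ * y * x) ∈ H ↔ Commute (f x) (f y) := by
    intro y
    rw [← QuotientGroup.eq_one_iff]
    change f _ = 1 ↔ _
    simp only [map_mul, map_inv]
    rw [inv_mul_eq_one, eq_comm, mul_assoc, inv_mul_eq_iff_eq_mul, eq_comm]
    rfl
  rw [key, key, Subgroup.mem_upperCentralSeries_succ_iff]
  constructor
  · intro h
    have h1 : ∀ y, Commute (f x) (f y) := by
      intro y
      have := (QuotientGroup.eq_one_iff (N := H) _).2 (h y)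
      change f _ = 1 at this
      rw [map_commutatorElement, commutatorElement_eq_one_iff_commute] at this
      exact this
    exact ⟨h1 a, h1 b⟩
  · rintro ⟨h1, h2⟩ y
    have h3 := commute_of_closure_pair
      (closure_pair_map hab f (QuotientGroup.mk'_surjective _)) h1 h2
    rw [← QuotientGroup.eq_one_iff]
    change f _ = 1
    rw [map_commutatorElement, commutatorElement_eq_one_iff_commute]
    exact (Subgroup.mem_center_iff.1 h3 (f y)).symm

theorem heisMk_zpow_left {R : Type*} [CommRing R] (x : R) (i : ℤ) :
    heisMk x 0 0 ^ i = heisMk (i * x) 0 0 := by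
  obtain ⟨n, rfl | rfl⟩ := Int.eq_nat_or_neg i
  · rw [zpow_natCast, heisMk_pow]
    simp
  · rw [zpow_neg, zpow_natCast, heisMk_pow, inv_eq_iff_mul_eq_one, heisMk_mul, ← heisMk_zero,
      heisMk_inj]
    simp

theorem heisMk_zpow_right {R : Type*} [CommRing R] (y : R) (i : ℤ) :
    heisMk 0 y 0 ^ i = heisMk 0 (i * y) 0 := by
  obtain ⟨n, rfl | rfl⟩ := Int.eq_nat_or_neg i
  · rw [zpow_natCast, heisMk_pow]
    simp
  · rw [zpow_neg, zpow_natCast, heisMk_pow, inv_eq_iff_mul_eq_one, heisMk_mul, ← heisMk_zero,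
      heisMk_inj]
    simp

/-- The relations of the Sylow subgroup, together with the independence of its normal forms and
its Heisenberg quotient. -/
structure MacdonaldSylow {T : Type*} [Group T] (q : ℕ) (α : ℤ) (a b : T) : Prop
    extends MacdonaldCore q α a b where
  indep : ∀ i j k : ℤ, a ^ i * b ^ j * commR a b ^ k = 1 →
    (q : ℤ) ^ 2 ∣ j ∧ (q : ℤ) ^ 3 ∣ i - j ∧ (q : ℤ) ^ 2 ∣ k
  dvd_of_sq_dvd : ∀ k : ℕ, (q : ℤ) ^ 2 ∣ α ^ k - 1 → q ∣ k
  sq_dvd_of_cube_dvd : ∀ k : ℕ, (q : ℤ) ^ 3 ∣ α ^ k - 1 → q ^ 2 ∣ k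
  exists_heis : ∃ φ : T →* Heis (ZMod q), φ a = heisMk 1 0 0 ∧ φ b = heisMk 0 1 0

/-! ### Commutators of normal forms with the generators. -/

namespace MacdonaldCore

variable {T : Type*} [Group T] {q : ℕ} {α : ℤ} {a b : T}

/-- The factor `a ^ (q * i)` commutes with `a` and drops out. Conjugation by `b ^ (q * j)`
contributes `c ^ (q * j)` up to a central factor, and conjugation by `c ^ k` contributes `a ^ (α ^ k
- 1)`. -/
theorem exists_commutator_left (h : MacdonaldCore q α a b) :
    ∃ w : ℤ, ∀ (i j : ℤ) (k : ℕ), ∀ x, x = a ^ (q * i) * b ^ (q * j) * commR a b ^ k →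
      a⁻¹ * (x⁻¹ * a * x) =
        a ^ (α ^ k - 1) * commR a b ^ (q * j) * (a ^ q ^ 2) ^ (w * j) := by
  obtain ⟨w, hw⟩ := h.exists_conj_left
  refine ⟨w, fun i j k x hx => ?_⟩
  subst hx
  set c := commR a b with hc
  have h1 := h.pair.zpow_mul_commR_pow 1 k
  rw [one_mul, zpow_one, ← hc] at h1
  have hz := (h.commute_left (c ^ k)).zpow_left (w * j)
  calc a⁻¹ * ((a ^ (q * i) * b ^ (q * j) * c ^ k)⁻¹ * a * (a ^ (q * i) * b ^ (q * j) * c ^ k))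
      = a⁻¹ * ((c ^ k)⁻¹ * ((b ^ (q * j))⁻¹ * a * b ^ (q * j)) * c ^ k) := by group
    _ = a⁻¹ * ((c ^ k)⁻¹ * a * c ^ (q * j) * ((a ^ q ^ 2) ^ (w * j) * c ^ k)) := by
        rw [hw]; group
    _ = a⁻¹ * ((c ^ k)⁻¹ * (a * c ^ k) * c ^ (q * j) * (a ^ q ^ 2) ^ (w * j)) := by
        rw [hz.eq]; group
    _ = _ := by rw [h1, zpow_sub_one]; group

/-- The exponent of `c` is a multiple of `q` here, so that its power changes `b` only by a central
factor. The commutator with `a` is used first to reach this situation. -/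
theorem exists_commutator_right (h : MacdonaldCore q α a b) :
    ∃ v w : ℤ, ∀ (i j k : ℤ), ∀ x, x = a ^ (q * i) * b ^ (q * j) * commR a b ^ (q * k) →
      b⁻¹ * (x⁻¹ * b * x) = commR a b ^ (-(q * i)) * (a ^ q ^ 2) ^ (v * i + w * k) := by
  obtain ⟨v, hv⟩ := h.swap.exists_conj_left
  obtain ⟨w, hw⟩ := h.swap.exists_left_mul_commR
  rw [commR_swap, inv_pow, h.right_eq, inv_zpow'] at hw
  simp only [commR_swap a b, h.right_eq, inv_zpow'] at hv
  refine ⟨-v, w, fun i j k x hx => ?_⟩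
  subst hx
  have hbc : Commute (b ^ (q * j)) (commR a b ^ (q * k)) := by
    have := (h.commute_right_pow_commR.zpow_left j).zpow_right k
    rwa [← zpow_mul, zpow_commR] at this
  have hbc' : Commute (b ^ (q * j)) (commR a b ^ (-(q * i))) := by
    have := (h.commute_right_pow_commR.zpow_left j).zpow_right (-i)
    rwa [← zpow_mul, zpow_commR, mul_neg] at this
  set c := commR a b with hc
  set z := a ^ q ^ 2 with hz
  have hzc : ∀ (x : T) (n : ℤ), Commute (z ^ n) x := fun x n => (h.commute_left x).zpow_left n
  have h1 : (c ^ q)⁻¹ * b * c ^ q = b * z ^ w := by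
    have h3 : (c ^ q)⁻¹ * (b * z ^ (-w) * c ^ q) = (c ^ q)⁻¹ * (c ^ q * (b * (c ^ q)⁻¹)) * c ^ q := by
      rw [hw]; group
    rw [mul_assoc b, (hzc _ _).eq] at h3
    calc (c ^ q)⁻¹ * b * c ^ q = (c ^ q)⁻¹ * (b * (c ^ q * z ^ (-w))) * z ^ w := by group
      _ = _ := by rw [h3]; group
  have h2 := conj_zpow_of_commute h1 (hzc _ w).symm k
  rw [zpow_commR, ← zpow_mul, ← hc] at h2
  calc b⁻¹ * ((a ^ (q * i) * b ^ (q * j) * c ^ (q * k))⁻¹ * b *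
        (a ^ (q * i) * b ^ (q * j) * c ^ (q * k)))
      = b⁻¹ * ((c ^ (q * k))⁻¹ * ((b ^ (q * j))⁻¹ * ((a ^ (q * i))⁻¹ * b * a ^ (q * i)) *
        b ^ (q * j)) * c ^ (q * k)) := by group
    _ = b⁻¹ * ((c ^ (q * k))⁻¹ * b * ((b ^ (q * j))⁻¹ * (c ^ (-(q * i)) * (z ^ (-(v * i)) *
        b ^ (q * j)))) * c ^ (q * k)) := by
        rw [hv]; group
    _ = b⁻¹ * ((c ^ (q * k))⁻¹ * b * c ^ (q * k)) * (c ^ (-(q * i)) * z ^ (-(v * i))) := by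
        rw [(hzc _ _).eq, ← mul_assoc (c ^ _) (b ^ _), ← hbc'.eq, mul_assoc (b ^ _),
          inv_mul_cancel_left, mul_assoc _ _ (c ^ _), mul_assoc (c ^ _) _ (c ^ _), (hzc _ _).eq]
        group
    _ = _ := by
        rw [h2, inv_mul_cancel_left, ← (hzc _ (-(v * i))).eq, ← mul_assoc, ← zpow_add, (hzc _ _).eq]
        congr 2
        ring

theorem zpow_mul_commR_mul_center (h : MacdonaldCore q α a b) (i k w : ℤ) :
    a ^ i * commR a b ^ k * (a ^ q ^ 2) ^ w = a ^ (i + q ^ 2 * w) * commR a b ^ k := by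
  rw [mul_assoc, ← ((h.commute_left _).zpow_left _).eq, ← mul_assoc, ← zpow_sq, ← zpow_add]

theorem exists_commR_eq_natCast (h : MacdonaldCore q α a b) (k : ℤ) :
    ∃ n : ℕ, commR a b ^ (q * k) = commR a b ^ (q * n) := by
  have hq : (q : ℤ) ≠ 0 := by exact_mod_cast h.odd.pos.ne'
  obtain ⟨n, hn⟩ := Int.eq_ofNat_of_zero_le (Int.emod_nonneg k hq)
  refine ⟨n, ?_⟩
  have h1 : commR a b ^ ((q : ℤ) ^ 2 * (k / q)) = 1 := by
    rw [zpow_sq, h.commR_pow, one_zpow]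
  rw [← zpow_natCast, Nat.cast_mul, ← hn]
  conv_lhs => rw [← Int.emod_add_mul_ediv k q, mul_add, ← mul_assoc, ← sq, zpow_add, h1, mul_one]

theorem exists_commutator_left_eq (h : MacdonaldCore q α a b) (i j k : ℤ) (x : T)
    (hx : x = a ^ (q * i) * b ^ (q * j) * commR a b ^ (q * k)) :
    ∃ l : ℤ, a⁻¹ * (x⁻¹ * a * x) = (a ^ q ^ 2) ^ l * commR a b ^ (q * j) := by
  obtain ⟨w, hw⟩ := h.exists_commutator_left
  obtain ⟨n, hn⟩ := h.exists_commR_eq_natCast k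
  rw [hn] at hx
  obtain ⟨u, hu⟩ := h.exists_eq
  obtain ⟨t, ht⟩ := exists_pow_eq_of_odd h.odd hu
  obtain ⟨s, hs⟩ := sub_dvd_pow_sub_pow (α ^ q) 1 n
  refine ⟨t * s + w * j, ?_⟩
  rw [one_pow, ht, add_sub_cancel_left, ← ht, ← pow_mul] at hs
  rw [hw i j _ x hx, h.zpow_mul_commR_mul_center, hs, ← zpow_sq]
  congr 2
  ring

end MacdonaldCore

/-! ### The first three terms of the upper central series. -/

namespace MacdonaldSylow

variable {T : Type*} [Group T] {q : ℕ} {α : ℤ} {a b : T}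

theorem map_eq {φ : T →* Heis (ZMod q)} (ha : φ a = heisMk 1 0 0) (hb : φ b = heisMk 0 1 0)
    (i j : ℤ) (k : ℕ) :
    φ (a ^ i * b ^ j * commR a b ^ k) = heisMk (i : ZMod q) j (k + i * j) := by
  rw [map_mul, map_mul, map_zpow, map_zpow, map_pow, map_commR, ha, hb, commR_heisMk,
    heisMk_zpow_left, heisMk_zpow_right, heisMk_pow, heisMk_mul, heisMk_mul, heisMk_inj]
  simp [add_comm]

theorem exists_of_map_eq_one (h : MacdonaldSylow q α a b) {φ : T →* Heis (ZMod q)}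
    (ha : φ a = heisMk 1 0 0) (hb : φ b = heisMk 0 1 0) {x : T} (hx : φ x = 1) :
    ∃ i j k : ℤ, x = a ^ (q * i) * b ^ (q * j) * commR a b ^ (q * k) := by
  obtain ⟨i, j, k, rfl⟩ := h.exists_eq_mul x
  rw [map_eq ha hb, ← heisMk_zero, heisMk_inj] at hx
  obtain ⟨h1, h2, h3⟩ := hx
  rw [h1, zero_mul, add_zero] at h3
  obtain ⟨i, rfl⟩ := (ZMod.intCast_zmod_eq_zero_iff_dvd _ _).1 h1
  obtain ⟨j, rfl⟩ := (ZMod.intCast_zmod_eq_zero_iff_dvd _ _).1 h2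
  obtain ⟨k, rfl⟩ := (ZMod.natCast_eq_zero_iff _ _).1 h3
  exact ⟨i, j, k, by rw [← Nat.cast_mul, zpow_natCast]⟩

theorem map_word_eq_one {φ : T →* Heis (ZMod q)} (hq : Odd q) (i j k : ℤ) :
    φ (a ^ (q * i) * b ^ (q * j) * commR a b ^ (q * k)) = 1 := by
  simp only [zpow_mul, zpow_natCast, map_mul, map_zpow, map_pow, heis_pow_eq_one hq, one_zpow,
    one_mul]

/-- The image of `x` commutes with the two generators of the Heisenberg group, hence has zero
entries next to the diagonal. -/
theorem exists_of_commute (h : MacdonaldSylow q α a b) {φ : T →* Heis (ZMod q)}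
    (ha : φ a = heisMk 1 0 0) (hb : φ b = heisMk 0 1 0) {x : T}
    (hxa : φ (a⁻¹ * (x⁻¹ * a * x)) = 1) (hxb : φ (b⁻¹ * (x⁻¹ * b * x)) = 1) :
    ∃ (i j : ℤ) (k : ℕ), x = a ^ (q * i) * b ^ (q * j) * commR a b ^ k := by
  obtain ⟨i, j, k, rfl⟩ := h.exists_eq_mul x
  rw [map_mul, map_inv, inv_mul_eq_one, map_mul, map_mul, map_inv, map_eq ha hb, mul_assoc,
    eq_inv_mul_iff_mul_eq] at hxa hxb
  rw [ha, heisMk_mul, heisMk_mul, heisMk_inj] at hxa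
  rw [hb, heisMk_mul, heisMk_mul, heisMk_inj] at hxb
  have h1 : (j : ZMod q) = 0 := by linear_combination -hxa.2.2
  have h2 : (i : ZMod q) = 0 := by linear_combination hxb.2.2
  obtain ⟨i, rfl⟩ := (ZMod.intCast_zmod_eq_zero_iff_dvd _ _).1 h2
  obtain ⟨j, rfl⟩ := (ZMod.intCast_zmod_eq_zero_iff_dvd _ _).1 h1
  exact ⟨i, j, k, rfl⟩

theorem pos (h : MacdonaldSylow q α a b) : (q : ℤ) ≠ 0 := by exact_mod_cast h.odd.pos.ne'

theorem zpow_mul_zpow_commR_eq_one (h : MacdonaldSylow q α a b) {i k : ℤ}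
    (hx : a ^ i * commR a b ^ k = 1) : (q : ℤ) ^ 3 ∣ i ∧ (q : ℤ) ^ 2 ∣ k := by
  have := h.indep i 0 k (by rwa [zpow_zero, mul_one])
  rw [sub_zero] at this
  exact this.2

theorem zpow_right_eq (h : MacdonaldSylow q α a b) (j : ℤ) :
    b ^ ((q : ℤ) * (q * j)) = (a ^ q ^ 2) ^ (-j) := by
  rw [← mul_assoc, ← sq, MacdonaldCore.zpow_sq, h.right_eq, inv_zpow']

/-- The pattern serves `mem_two` and `mem_three` as well. The Heisenberg quotient makes the
exponents of `a` and `b` multiples of `q`; the commutator with `a` and `indep` then restrict the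
exponents of `b` and `c`. The commutator with `b`, where still needed, restricts that of `a`. -/
theorem mem_one (h : MacdonaldSylow q α a b) {x : T} :
    x ∈ Subgroup.upperCentralSeries T 1 ↔ ∃ l : ℤ, x = (a ^ q ^ 2) ^ l := by
  constructor
  · intro hx
    rw [mem_upperCentralSeries_succ_iff_of_closure h.closure_eq,
      Subgroup.upperCentralSeries_zero, Subgroup.mem_bot, Subgroup.mem_bot] at hx
    obtain ⟨φ, ha, hb⟩ := h.exists_heis
    obtain ⟨i, j, k, hxe⟩ := h.exists_of_commute ha hb (by rw [hx.1, map_one]) (by rw [hx.2, map_one])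
    obtain ⟨w, hw⟩ := h.exists_commutator_left
    obtain ⟨v, v', hv⟩ := h.exists_commutator_right
    have h1 := hx.1
    rw [hw i j k x hxe, mul_assoc, ← ((h.commute_left _).zpow_left _).eq, ← mul_assoc,
      ← MacdonaldCore.zpow_sq, ← zpow_add] at h1
    obtain ⟨h2, h3⟩ := h.zpow_mul_zpow_commR_eq_one h1
    rw [sq, mul_dvd_mul_iff_left h.pos] at h3
    obtain ⟨j, rfl⟩ := h3
    have h4 : (q : ℤ) ^ 3 ∣ α ^ k - 1 := by
      rw [show (q : ℤ) ^ 2 * (w * (q * j)) = q ^ 3 * (w * j) by ring] at h2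
      exact (dvd_add_left (dvd_mul_right _ _)).1 h2
    obtain ⟨k, rfl⟩ := h.sq_dvd_of_cube_dvd k h4
    rw [pow_mul, h.commR_pow, one_pow, mul_one, h.zpow_right_eq] at hxe
    -- The exponent of `b` is now a multiple of `q ^ 2`, so this factor is absorbed into the power
    -- of `a`.
    have h5 : x = a ^ (q * (i - q * j)) * b ^ ((q : ℤ) * 0) * commR a b ^ ((q : ℤ) * 0) := by
      rw [hxe, ← MacdonaldCore.zpow_sq, ← zpow_add, mul_zero, zpow_zero, zpow_zero, mul_one, mul_one]
      congr 1
      ring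
    have h6 := hx.2
    rw [hv _ _ _ x h5, ← ((h.commute_left _).zpow_left _).eq, ← MacdonaldCore.zpow_sq] at h6
    have h7 := (h.zpow_mul_zpow_commR_eq_one h6).2
    rw [dvd_neg, sq, mul_dvd_mul_iff_left h.pos] at h7
    obtain ⟨l, hl⟩ := h7
    refine ⟨l, ?_⟩
    rw [h5, hl, ← MacdonaldCore.zpow_sq, mul_zero, zpow_zero, zpow_zero, mul_one, mul_one]
    congr 1
    ring
  · rintro ⟨l, rfl⟩
    rw [Subgroup.upperCentralSeries_one]
    exact zpow_mem h.left_mem_center l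

theorem map_center_mul_commR_eq_one {φ : T →* Heis (ZMod q)} (hq : Odd q) (l k : ℤ) :
    φ ((a ^ q ^ 2) ^ l * commR a b ^ (q * k)) = 1 := by
  have := map_word_eq_one (a := a) (b := b) (φ := φ) hq (q * l) 0 k
  rwa [mul_zero, zpow_zero, mul_one, ← mul_assoc, ← sq, MacdonaldCore.zpow_sq] at this

theorem mem_two (h : MacdonaldSylow q α a b) {x : T} :
    x ∈ Subgroup.upperCentralSeries T 2 ↔
      ∃ l k : ℤ, x = (a ^ q ^ 2) ^ l * commR a b ^ (q * k) := by
  obtain ⟨v, v', hv⟩ := h.exists_commutator_right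
  rw [mem_upperCentralSeries_succ_iff_of_closure h.closure_eq, h.mem_one, h.mem_one]
  constructor
  · rintro ⟨⟨l, hl⟩, ⟨l', hl'⟩⟩
    obtain ⟨w, hw⟩ := h.exists_commutator_left
    obtain ⟨φ, ha, hb⟩ := h.exists_heis
    have hφ : ∀ l : ℤ, φ ((a ^ q ^ 2) ^ l) = 1 := fun l => by
      have := map_center_mul_commR_eq_one (a := a) (b := b) (φ := φ) h.odd l 0
      rwa [mul_zero, zpow_zero, mul_one] at this
    obtain ⟨i, j, k, hxe⟩ := h.exists_of_commute ha hb (by rw [hl, hφ]) (by rw [hl', hφ])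
    rw [hw i j k x hxe, ← mul_inv_eq_one, ← zpow_neg, h.zpow_mul_commR_mul_center,
      h.zpow_mul_commR_mul_center] at hl
    obtain ⟨h2, h3⟩ := h.zpow_mul_zpow_commR_eq_one hl
    rw [sq, mul_dvd_mul_iff_left h.pos] at h3
    obtain ⟨j, rfl⟩ := h3
    have h4 : (q : ℤ) ^ 2 ∣ α ^ k - 1 := by
      have h5 := (pow_dvd_pow (q : ℤ) (show 2 ≤ 3 by omega)).trans h2
      rw [add_assoc, ← mul_add] at h5
      exact (dvd_add_left (dvd_mul_right _ _)).1 h5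
    obtain ⟨k, rfl⟩ := h.dvd_of_sq_dvd k h4
    have hxe' : x = a ^ (q * i) * b ^ (q * (q * j)) * commR a b ^ ((q : ℤ) * k) := by
      rw [hxe]
      norm_cast
    rw [hv _ _ _ x hxe', ← ((h.commute_left _).zpow_left _).eq, eq_comm, ← inv_mul_eq_one,
      ← zpow_neg, ← mul_assoc, ← MacdonaldCore.zpow_sq, ← MacdonaldCore.zpow_sq, ← zpow_add] at hl'
    have h7 := (h.zpow_mul_zpow_commR_eq_one hl').2
    rw [dvd_neg, sq, mul_dvd_mul_iff_left h.pos] at h7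
    obtain ⟨i, rfl⟩ := h7
    refine ⟨i - j, k, ?_⟩
    rw [hxe', h.zpow_right_eq, ← mul_assoc, ← sq, MacdonaldCore.zpow_sq, ← zpow_add, sub_eq_add_neg]
  · rintro ⟨l, k, rfl⟩
    have hx : (a ^ q ^ 2) ^ l * commR a b ^ (q * k) =
        a ^ (q * (q * l)) * b ^ ((q : ℤ) * 0) * commR a b ^ (q * k) := by
      rw [mul_zero, zpow_zero, mul_one, ← mul_assoc, ← sq, MacdonaldCore.zpow_sq]
    constructor
    · obtain ⟨r, hr⟩ := h.exists_commutator_left_eq _ _ _ _ hx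
      exact ⟨r, by rw [hr, mul_zero, zpow_zero, mul_one]⟩
    · refine ⟨v * (q * l) + v' * k, ?_⟩
      rw [hv _ _ _ _ hx, ← mul_assoc, ← sq, ← mul_neg, MacdonaldCore.zpow_sq, h.commR_pow,
        one_zpow, one_mul]

theorem mem_three (h : MacdonaldSylow q α a b) {x : T} :
    x ∈ Subgroup.upperCentralSeries T 3 ↔
      ∃ i j k : ℤ, x = a ^ (q * i) * b ^ (q * j) * commR a b ^ (q * k) := by
  rw [mem_upperCentralSeries_succ_iff_of_closure h.closure_eq, h.mem_two, h.mem_two]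
  constructor
  · rintro ⟨⟨l, r, hl⟩, ⟨l', r', hl'⟩⟩
    obtain ⟨w, hw⟩ := h.exists_commutator_left
    obtain ⟨φ, ha, hb⟩ := h.exists_heis
    have hφ := map_center_mul_commR_eq_one (a := a) (b := b) (φ := φ) h.odd
    obtain ⟨i, j, k, hxe⟩ := h.exists_of_commute ha hb (by rw [hl, hφ]) (by rw [hl', hφ])
    rw [hw i j k x hxe, h.zpow_mul_commR_mul_center] at hl
    have h1 : a ^ (α ^ k - 1 + q ^ 2 * (w * j) + q ^ 2 * -l) *
        commR a b ^ ((q : ℤ) * j - q * r) = 1 := by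
      rw [← h.zpow_mul_commR_mul_center, zpow_sub, ← mul_assoc, hl, mul_inv_cancel_right,
        ← zpow_add, add_neg_cancel, zpow_zero]
    have h2 := (pow_dvd_pow (q : ℤ) (show 2 ≤ 3 by omega)).trans (h.zpow_mul_zpow_commR_eq_one h1).1
    rw [add_assoc, ← mul_add] at h2
    obtain ⟨k, rfl⟩ := h.dvd_of_sq_dvd k ((dvd_add_left (dvd_mul_right _ _)).1 h2)
    exact ⟨i, j, k, by rw [hxe]; norm_cast⟩
  · rintro ⟨i, j, k, hx⟩
    obtain ⟨v, v', hv⟩ := h.exists_commutator_right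
    constructor
    · obtain ⟨r, hr⟩ := h.exists_commutator_left_eq _ _ _ _ hx
      exact ⟨r, j, hr⟩
    · refine ⟨v * i + v' * k, -i, ?_⟩
      rw [hv _ _ _ _ hx, ← ((h.commute_left _).zpow_left _).eq, mul_neg]

end MacdonaldSylow

/-! ### Power subgroups, exponent and quotient. -/

namespace MacdonaldCore

variable {T : Type*} [Group T] {q : ℕ} {α : ℤ} {a b : T}

/-- Conjugation by `b ^ q` turns `a` into `a * c ^ q` times a central element, and `c ^ q` commutes
with `a` up to a central element of exponent `q`. In the `q`-th power all corrections vanish,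
because the odd number `q` divides `q.choose 2`. -/
theorem commute_pow_pow (h : MacdonaldCore q α a b) : Commute (a ^ q) (b ^ q) := by
  obtain ⟨w, hw⟩ := h.exists_conj_left
  obtain ⟨v, hv⟩ := h.exists_left_mul_commR
  have hz := fun (g : T) (n : ℤ) => (h.commute_left g).zpow_left n
  have hv' : commR a b ^ q * a = a * commR a b ^ q * (a ^ q ^ 2) ^ (-v) := by
    rw [hv, zpow_neg, mul_inv_cancel_right]
  have hq : ∀ n : ℤ, ((a ^ q ^ 2) ^ n) ^ q = 1 := fun n => by
    rw [← zpow_natCast, ← zpow_mul, mul_comm, h.zpow_center_pow]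
  obtain ⟨r, hr⟩ : q ∣ q.choose 2 := by
    obtain ⟨r, hr⟩ := h.odd
    refine ⟨r, ?_⟩
    rw [Nat.choose_two_right, hr, Nat.add_sub_cancel, mul_left_comm,
      Nat.mul_div_cancel_left _ two_pos]
  have h1 := conj_pow (a := (b ^ q)⁻¹) (b := a) (i := q)
  have h2 := hw 1
  rw [mul_one, zpow_natCast, zpow_natCast] at h2
  rw [inv_inv, h2, ((hz _ _).symm).mul_pow, hq, mul_one,
    mul_pow_of_commutator_central hv' (fun g => hz g _), hr, pow_mul _ q r, hq, one_pow, mul_one,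
    ← pow_mul, ← sq, h.commR_pow, mul_one, mul_assoc, eq_inv_mul_iff_mul_eq] at h1
  exact h1.symm

theorem word_pow (h : MacdonaldCore q α a b) (i j k : ℤ) :
    (a ^ (q * i) * b ^ (q * j) * commR a b ^ (q * k)) ^ q = (a ^ q ^ 2) ^ (i - j) := by
  have hac := h.commute_left_pow_commR
  have hbc := h.commute_right_pow_commR
  rw [zpow_natCast] at hac hbc
  have hab := h.commute_pow_pow
  have hc : commR a b ^ (q * q) = 1 := by rw [← sq, h.commR_pow]
  simp only [zpow_mul, zpow_natCast]
  rw [(((hac.zpow_zpow i k).mul_left (hbc.zpow_zpow j k))).mul_pow, (hab.zpow_zpow i j).mul_pow]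
  have hp : ∀ (g : T) (n : ℤ), ((g ^ q) ^ n) ^ q = (g ^ (q * q)) ^ n := fun g n => by
    rw [← zpow_natCast, ← zpow_mul, mul_comm, zpow_mul, zpow_natCast, pow_mul]
  rw [hp, hp, hp, hc, ← sq, h.right_eq, inv_zpow', one_zpow, mul_one, ← zpow_add, sub_eq_add_neg]

end MacdonaldCore

namespace MacdonaldSylow

variable {T : Type*} [Group T] {q : ℕ} {α : ℤ} {a b : T}

theorem exists_pow_eq (h : MacdonaldSylow q α a b) (t : T) :
    ∃ i j k : ℤ, t ^ q = a ^ (q * i) * b ^ (q * j) * commR a b ^ (q * k) := by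
  obtain ⟨φ, ha, hb⟩ := h.exists_heis
  exact h.exists_of_map_eq_one ha hb (by rw [map_pow, heis_pow_eq_one h.odd])

/-- `t ^ q` dies in the Heisenberg quotient, so it is a word to which `word_pow` applies. -/
theorem exists_pow_sq_eq (h : MacdonaldSylow q α a b) (t : T) :
    ∃ l : ℤ, t ^ q ^ 2 = (a ^ q ^ 2) ^ l := by
  obtain ⟨i, j, k, ht⟩ := h.exists_pow_eq t
  exact ⟨i - j, by rw [← h.word_pow i j k, ← ht, ← pow_mul, ← sq]⟩

theorem center_eq (h : MacdonaldSylow q α a b) :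
    Subgroup.center T = powSubgroup T (q ^ 2) := by
  apply le_antisymm
  · intro x hx
    rw [← Subgroup.upperCentralSeries_one, h.mem_one] at hx
    obtain ⟨l, rfl⟩ := hx
    exact Subgroup.zpow_mem _ (Subgroup.subset_closure (Set.mem_range_self a)) l
  · rw [powSubgroup, Subgroup.closure_le]
    rintro _ ⟨t, rfl⟩
    obtain ⟨l, hl⟩ := h.exists_pow_sq_eq t
    show t ^ q ^ 2 ∈ Subgroup.center T
    rw [hl]
    exact zpow_mem h.left_mem_center l

theorem upperCentralSeries_three_eq (h : MacdonaldSylow q α a b) :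
    Subgroup.upperCentralSeries T 3 = powSubgroup T q := by
  apply le_antisymm
  · intro x hx
    rw [h.mem_three] at hx
    obtain ⟨i, j, k, rfl⟩ := hx
    have hp : ∀ (g : T) (n : ℤ), g ^ (q * n) ∈ powSubgroup T q := fun g n => by
      rw [zpow_mul, zpow_natCast]
      exact Subgroup.zpow_mem _ (Subgroup.subset_closure (Set.mem_range_self g)) n
    exact mul_mem (mul_mem (hp _ _) (hp _ _)) (hp _ _)
  · rw [powSubgroup, Subgroup.closure_le]
    rintro _ ⟨t, rfl⟩
    exact h.mem_three.2 (h.exists_pow_eq t)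

theorem exponent_eq (h : MacdonaldSylow q α a b) : Monoid.exponent T = q ^ 3 := by
  apply Nat.dvd_antisymm
  · refine Monoid.exponent_dvd_of_forall_pow_eq_one fun t => ?_
    obtain ⟨l, hl⟩ := h.exists_pow_sq_eq t
    rw [pow_succ, pow_mul, hl, ← zpow_natCast, ← zpow_mul, mul_comm, h.zpow_center_pow]
  · have h1 := h.indep (Monoid.exponent T) 0 0
      (by rw [zpow_natCast, Monoid.pow_exponent_eq_one, zpow_zero, zpow_zero, mul_one, mul_one])
    rw [sub_zero] at h1
    exact_mod_cast h1.2.1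

theorem nonempty_quotient_mulEquiv (h : MacdonaldSylow q α a b) :
    Nonempty (T ⧸ Subgroup.upperCentralSeries T 3 ≃* Heis (ZMod q)) := by
  obtain ⟨φ, ha, hb⟩ := h.exists_heis
  have : NeZero q := ⟨h.odd.pos.ne'⟩
  have hφ : Function.Surjective φ := by
    intro M
    obtain ⟨x, y, z, rfl⟩ := exists_eq_heisMk M
    refine ⟨a ^ (x.cast : ℤ) * b ^ (y.cast : ℤ) * commR a b ^ (z - x * y).val, ?_⟩
    rw [map_eq ha hb, heisMk_inj]
    simp
  have hker : φ.ker = Subgroup.upperCentralSeries T 3 := by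
    ext x
    rw [MonoidHom.mem_ker, h.mem_three]
    refine ⟨h.exists_of_map_eq_one ha hb, ?_⟩
    rintro ⟨i, j, k, rfl⟩
    exact map_word_eq_one h.odd i j k
  exact ⟨(QuotientGroup.quotientMulEquivOfEq hker.symm).trans
    (QuotientGroup.quotientKerEquivOfSurjective φ hφ)⟩

theorem commute_of_mem_three (h : MacdonaldSylow q α a b) {x y : T}
    (hx : x ∈ Subgroup.upperCentralSeries T 3) (hy : y ∈ Subgroup.upperCentralSeries T 3) :
    Commute x y := by
  have hac := h.commute_left_pow_commR
  have hbc := h.commute_right_pow_commR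
  rw [zpow_natCast] at hac hbc
  have hab := h.commute_pow_pow
  obtain ⟨i, j, k, rfl⟩ := h.mem_three.1 hx
  obtain ⟨i', j', k', rfl⟩ := h.mem_three.1 hy
  simp only [zpow_mul, zpow_natCast]
  refine .mul_left (.mul_left ?_ ?_) ?_ <;> refine .mul_right (.mul_right ?_ ?_) ?_ <;>
    apply Commute.zpow_zpow
  exacts [.refl _, hab, hac, hab.symm, .refl _, hbc, hac.symm, hbc.symm, .refl _]

theorem word_eq_one_iff (h : MacdonaldSylow q α a b) {i j k : ℤ} :
    a ^ (q * i) * b ^ (q * j) * commR a b ^ (q * k) = 1 ↔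
      (q : ℤ) ∣ j ∧ (q : ℤ) ^ 2 ∣ i - j ∧ (q : ℤ) ∣ k := by
  have h2 : ∀ j : ℤ, (q : ℤ) ^ 2 ∣ q * j ↔ (q : ℤ) ∣ j := fun j => by
    rw [sq, mul_dvd_mul_iff_left h.pos]
  have h3 : ∀ j : ℤ, (q : ℤ) ^ 3 ∣ q * j ↔ (q : ℤ) ^ 2 ∣ j := fun j => by
    rw [pow_succ', mul_dvd_mul_iff_left h.pos]
  constructor
  · intro hx
    have := h.indep _ _ _ hx
    rwa [← mul_sub, h2, h3, h2] at this
  · rintro ⟨⟨j, rfl⟩, ⟨l, hl⟩, ⟨k, rfl⟩⟩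
    obtain rfl := eq_add_of_sub_eq hl
    rw [h.zpow_right_eq, ← mul_assoc (q : ℤ) q k, ← sq, MacdonaldCore.zpow_sq, h.commR_pow,
      one_zpow, mul_one, show (q : ℤ) * (q ^ 2 * l + q * j) = q ^ 2 * (q * l + j) by ring,
      MacdonaldCore.zpow_sq, ← zpow_add, add_neg_cancel_right, h.zpow_center_pow]

theorem pow_mem_three (h : MacdonaldSylow q α a b) (x : T) :
    x ^ q ∈ Subgroup.upperCentralSeries T 3 := by
  rw [h.upperCentralSeries_three_eq]
  exact Subgroup.subset_closure ⟨x, rfl⟩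

end MacdonaldSylow

/-! ### Presentation and order of the third term. -/

namespace PresentedGroup

theorem exists_zThree_eq {p m : ℕ} (x : PresentedGroup (zThreeRels p m)) : ∃ i j k : ℤ,
    x = of 0 ^ i * of 1 ^ j * of 2 ^ k := by
  set X : PresentedGroup (zThreeRels p m) := of 0 with hX
  set Y : PresentedGroup (zThreeRels p m) := of 1 with hY
  set Z : PresentedGroup (zThreeRels p m) := of 2 with hZ
  have hrel : ∀ r ∈ zThreeRels p m, mk (zThreeRels p m) r = 1 := fun r hr => one_of_mem hr
  have hXY : Commute X Y := by
    have := hrel _ (Or.inl rfl)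
    rw [map_mul, map_inv, mul_inv_eq_one, map_mul, map_mul] at this
    exact this
  have hYZ : Commute Y Z := by
    have := hrel _ (Or.inr (Or.inl rfl))
    rw [map_mul, map_inv, mul_inv_eq_one, map_mul, map_mul] at this
    exact this
  have hXZ : Commute X Z := by
    have := hrel _ (Or.inr (Or.inr (Or.inl rfl)))
    rw [map_mul, map_inv, mul_inv_eq_one, map_mul, map_mul] at this
    exact this
  have hx : x ∈ Subgroup.closure (Set.range (of (rels := zThreeRels p m))) := by
    rw [closure_range_of]; trivial
  induction hx using Subgroup.closure_induction_left with
  | one => exact ⟨0, 0, 0, by simp⟩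
  | mul_left y hy g _ ih =>
    obtain ⟨n, rfl⟩ := hy
    obtain ⟨i, j, k, rfl⟩ := ih
    fin_cases n
    · exact ⟨1 + i, j, k, by rw [zpow_one_add]; simp only [mul_assoc]; rfl⟩
    · refine ⟨i, 1 + j, k, ?_⟩
      rw [zpow_one_add, ← mul_assoc (X ^ i), (hXY.zpow_left i).eq]
      simp only [mul_assoc]; rfl
    · refine ⟨i, j, 1 + k, ?_⟩
      rw [zpow_one_add, ← mul_assoc _ Z, ((hXZ.zpow_left i).mul_left (hYZ.zpow_left j)).eq]
      simp only [mul_assoc]; rfl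
  | inv_mul_cancel y hy g _ ih =>
    obtain ⟨n, rfl⟩ := hy
    obtain ⟨i, j, k, rfl⟩ := ih
    fin_cases n
    · exact ⟨-1 + i, j, k, by rw [zpow_add, zpow_neg_one]; simp only [mul_assoc]; rfl⟩
    · refine ⟨i, -1 + j, k, ?_⟩
      rw [zpow_add _ (-1), zpow_neg_one, ← mul_assoc (X ^ i), ((hXY.zpow_left i).inv_right).eq]
      simp only [mul_assoc]; rfl
    · refine ⟨i, j, -1 + k, ?_⟩
      rw [zpow_add _ (-1), zpow_neg_one, ← mul_assoc _ Z⁻¹,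
        ((hXZ.zpow_left i).mul_left (hYZ.zpow_left j)).inv_right.eq]
      simp only [mul_assoc]; rfl

end PresentedGroup

namespace MacdonaldSylow

variable {T : Type*} [Group T] {q : ℕ} {α : ℤ} {a b : T}

/-- Injectivity holds because the divisibility conditions under which a word is trivial in `T`
(`word_eq_one_iff`) already make it trivial by the relators. -/
theorem nonempty_three_mulEquiv {p m : ℕ} (h : MacdonaldSylow (p ^ m) α a b) :
    Nonempty (Subgroup.upperCentralSeries T 3 ≃* PresentedGroup (zThreeRels p m)) := by
  set q := p ^ m with hq
  set N := Subgroup.upperCentralSeries T 3 with hN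
  set f : Fin 3 → N := ![⟨a ^ q, h.pow_mem_three a⟩, ⟨b ^ q, h.pow_mem_three b⟩,
    ⟨commR a b ^ q, h.pow_mem_three _⟩] with hf
  have hcomm : ∀ x y : N, x * y = y * x := fun x y =>
    Subtype.ext (h.commute_of_mem_three x.2 y.2).eq
  have h2 : p ^ (2 * m) = q ^ 2 := by rw [mul_comm, pow_mul]
  have hrel : ∀ r ∈ zThreeRels p m, FreeGroup.lift f r = 1 := by
    rintro r (rfl | rfl | rfl | rfl | rfl | rfl)
    · simp only [map_mul, map_inv, mul_inv_eq_one]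
      exact hcomm _ _
    · simp only [map_mul, map_inv, mul_inv_eq_one]
      exact hcomm _ _
    · simp only [map_mul, map_inv, mul_inv_eq_one]
      exact hcomm _ _
    · rw [map_pow, FreeGroup.lift_apply_of, h2]
      refine Subtype.ext ?_
      show (a ^ q) ^ q ^ 2 = 1
      rw [← pow_mul, ← pow_succ', h.left_pow]
    · rw [map_mul, map_pow, map_pow, FreeGroup.lift_apply_of, FreeGroup.lift_apply_of]
      refine Subtype.ext ?_
      show (a ^ q) ^ q * (b ^ q) ^ q = 1
      rw [← pow_mul, ← pow_mul, ← sq, h.mul_pow]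
    · rw [map_pow, FreeGroup.lift_apply_of]
      refine Subtype.ext ?_
      show (commR a b ^ q) ^ q = 1
      rw [← pow_mul, ← sq, h.commR_pow]
  set F := PresentedGroup.toGroup hrel with hF
  have hFw : ∀ i j k : ℤ, (F (.of 0 ^ i * .of 1 ^ j * .of 2 ^ k) : T) =
      a ^ (q * i) * b ^ (q * j) * commR a b ^ (q * k) := by
    intro i j k
    simp only [zpow_mul, zpow_natCast, map_mul, map_zpow, hF, PresentedGroup.toGroup.of]
    rfl
  have hsurj : Function.Surjective F := by
    rintro ⟨x, hx⟩
    obtain ⟨i, j, k, rfl⟩ := h.mem_three.1 hx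
    exact ⟨_, Subtype.ext (hFw i j k)⟩
  have hinj : Function.Injective F := by
    rw [injective_iff_map_eq_one]
    intro x hx
    obtain ⟨i, j, k, rfl⟩ := PresentedGroup.exists_zThree_eq x
    have h1 := hFw i j k
    rw [hx, eq_comm] at h1
    obtain ⟨⟨j, rfl⟩, ⟨l, hl⟩, ⟨k, rfl⟩⟩ := h.word_eq_one_iff.1 h1
    obtain rfl := eq_add_of_sub_eq hl
    have hr : ∀ r ∈ zThreeRels p m, PresentedGroup.mk (zThreeRels p m) r = 1 :=
      fun r hr => PresentedGroup.one_of_mem hr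
    have e1 := hr _ (Or.inr (Or.inr (Or.inr (Or.inl rfl))))
    have e2 := hr _ (Or.inr (Or.inr (Or.inr (Or.inr (Or.inl rfl)))))
    have e3 := hr _ (Or.inr (Or.inr (Or.inr (Or.inr (Or.inr rfl)))))
    rw [map_pow, h2] at e1
    rw [map_mul, map_pow, map_pow] at e2
    rw [map_pow] at e3
    change PresentedGroup.of 0 ^ q ^ 2 = 1 at e1
    change PresentedGroup.of 0 ^ q * PresentedGroup.of 1 ^ q = 1 at e2
    change PresentedGroup.of 2 ^ q = 1 at e3
    rw [zpow_add, zpow_mul _ ((q : ℤ) ^ 2), zpow_mul _ (q : ℤ), zpow_mul _ (q : ℤ),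
      zpow_mul _ (q : ℤ), zpow_natCast, zpow_natCast, zpow_natCast, e3, eq_inv_of_mul_eq_one_right e2]
    rw [← Nat.cast_pow, zpow_natCast, e1]
    simp
  exact ⟨(MulEquiv.ofBijective F ⟨hinj, hsurj⟩).symm⟩

theorem card_three (h : MacdonaldSylow q α a b) :
    Nat.card (Subgroup.upperCentralSeries T 3) = q ^ 4 := by
  have hac := h.commute_left_pow_commR
  have hbc := h.commute_right_pow_commR
  rw [zpow_natCast] at hac hbc
  have hab := h.commute_pow_pow
  set N := Subgroup.upperCentralSeries T 3 with hN
  -- Shifting the exponent of `a` by that of `b` decouples the conditions of `word_eq_one_iff`: the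
  -- first coordinate counts modulo `q ^ 2`, the others modulo `q`.
  let F : ZMod (q ^ 2) × ZMod q × ZMod q → N := fun x =>
    ⟨a ^ (q * (x.1.cast + x.2.1.cast) : ℤ) * b ^ (q * x.2.1.cast : ℤ) *
      commR a b ^ (q * x.2.2.cast : ℤ), h.mem_three.2 ⟨_, _, _, rfl⟩⟩
  have hmul : ∀ i j k i' j' k' : ℤ, a ^ (q * i) * b ^ (q * j) * commR a b ^ (q * k) *
      (a ^ (q * i') * b ^ (q * j') * commR a b ^ (q * k')) =
      a ^ (q * (i + i')) * b ^ (q * (j + j')) * commR a b ^ (q * (k + k')) := by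
    intro i j k i' j' k'
    simp only [zpow_mul, zpow_natCast, zpow_add]
    rw [((hac.symm.zpow_zpow k i').mul_right (hbc.symm.zpow_zpow k j')).mul_mul_mul_comm,
      (hab.symm.zpow_zpow j i').mul_mul_mul_comm]
  have hword : ∀ i j k i' j' k' : ℤ, a ^ (q * i) * b ^ (q * j) * commR a b ^ (q * k) =
      a ^ (q * i') * b ^ (q * j') * commR a b ^ (q * k') ↔
      (q : ℤ) ∣ j - j' ∧ (q : ℤ) ^ 2 ∣ i - i' - (j - j') ∧ (q : ℤ) ∣ k - k' := by
    intro i j k i' j' k'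
    rw [← h.word_eq_one_iff]
    conv_lhs => rw [← sub_add_cancel i i', ← sub_add_cancel j j', ← sub_add_cancel k k', ← hmul,
      mul_eq_right]
  have : NeZero q := ⟨h.odd.pos.ne'⟩
  have hbij : Function.Bijective F := by
    constructor
    · rintro ⟨i, j, k⟩ ⟨i', j', k'⟩ hx
      obtain ⟨h1, h2, h3⟩ := (hword _ _ _ _ _ _).1 (Subtype.ext_iff.1 hx)
      have h2' : ((q ^ 2 : ℕ) : ℤ) ∣ (i.cast : ℤ) - i'.cast := by
        have e : (i.cast : ℤ) + j.cast - (i'.cast + j'.cast) - (j.cast - j'.cast) =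
          i.cast - i'.cast := by ring
        rw [Nat.cast_pow, ← e]
        exact h2
      rw [← ZMod.intCast_eq_intCast_iff_dvd_sub, ZMod.intCast_zmod_cast,
        ZMod.intCast_zmod_cast] at h1 h2' h3
      exact Prod.ext h2'.symm (Prod.ext h1.symm h3.symm)
    · rintro ⟨x, hx⟩
      obtain ⟨i, j, k, rfl⟩ := h.mem_three.1 hx
      refine ⟨((i - j : ℤ), (j : ℤ), (k : ℤ)), Subtype.ext ((hword _ _ _ _ _ _).2 ?_)⟩
      have hr : ∀ (n : ℕ) (i : ℤ), (n : ℤ) ∣ ((i : ZMod n).cast : ℤ) - i := fun n i => by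
        rw [← ZMod.intCast_eq_intCast_iff_dvd_sub, ZMod.intCast_zmod_cast]
      refine ⟨hr _ _, ?_, hr _ _⟩
      convert hr (q ^ 2) (i - j) using 1
      · exact (Nat.cast_pow _ _).symm
      · ring
  rw [← Nat.card_eq_of_bijective F hbij, Nat.card_prod, Nat.card_prod, Nat.card_zmod, Nat.card_zmod]
  ring

end MacdonaldSylow

/-! ### Valuations, and the core relations in a `p`-group. -/

/-- Lifting the exponent: for odd `p` the valuation of `α ^ k - 1` is `m` plus that of `k`. -/
theorem pow_dvd_of_pow_dvd_pow_sub_one {p : ℕ} (hp : p.Prime) (hp2 : p ≠ 2) {m : ℕ} (hm : 0 < m)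
    {α u : ℤ} (hα : α = 1 + p ^ m * u) (hu : ¬(p : ℤ) ∣ u) {n k : ℕ}
    (h : (p : ℤ) ^ (m + n) ∣ α ^ k - 1) : p ^ n ∣ k := by
  have hpi := Nat.prime_iff_prime_int.1 hp
  have hpm : (p : ℤ) ∣ p ^ m * u := (dvd_pow_self _ hm.ne').mul_right _
  have h1 : emultiplicity (p : ℤ) (α - 1) = m := by
    rw [hα, add_sub_cancel_left, emultiplicity_mul hpi, emultiplicity_eq_zero.2 hu, add_zero,
      emultiplicity_pow_self hpi.ne_zero hpi.not_isUnit]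
  have hpα : ¬(p : ℤ) ∣ α := fun hd => by
    rw [hα] at hd
    exact hpi.not_isUnit (isUnit_of_dvd_one ((dvd_add_left hpm).1 hd))
  have h2 := Int.emultiplicity_pow_sub_pow hp (hp.odd_of_ne_two hp2) (x := α) (y := 1)
    (by rw [hα, add_sub_cancel_left]; exact hpm) hpα k
  rw [one_pow, h1] at h2
  rw [pow_dvd_iff_le_emultiplicity, h2, Nat.cast_add] at h
  rw [pow_dvd_iff_le_emultiplicity]
  exact (ENat.add_le_add_iff_left (ENat.natCast_ne_top m)).1 h

namespace IsMacdonaldPair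

/-- Write `D` for the defect. Expanding the geometric sum gives `6 D ≡ 3 μ²` modulo `p μ²` when `p >
3`. For `p = 3` and `μ = 3 ν`, the cubic term coming from `μ.choose 3` is no longer negligible and
`2 D ≡ (1 + ν) μ²` modulo `3 μ²`. Hence the condition on `ν`. -/
theorem exists_defect_eq {p m : ℕ} (hp : p.Prime) (hm : 0 < m) {μ : ℕ} {u : ℤ}
    (hμ : (μ : ℤ) = p ^ m * u) (hu : ¬(p : ℤ) ∣ u)
    (hcase : 3 < p ∨ p = 3 ∧ ∃ ν : ℤ, (μ : ℤ) = 3 * ν ∧ ¬(3 : ℤ) ∣ 1 + ν) :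
    ∃ e : ℤ, defect (1 + μ) μ = p ^ (2 * m) * e ∧ ¬(p : ℤ) ∣ e := by
  have hpi := Nat.prime_iff_prime_int.1 hp
  obtain ⟨t, ht⟩ := exists_geomSum_eq μ μ
  have hg := geomSum_mul (1 + μ) μ
  have h2 := two_mul_cast_choose_two ℤ μ
  have h6 : 6 * (μ.choose 3 : ℤ) = μ * (μ - 1) * (μ - 2) := six_mul_cast_choose_three ℤ μ
  have hpμ : (p : ℤ) ∣ μ := hμ ▸ (dvd_pow_self _ hm.ne').mul_right _
  have hE : defect (1 + μ) μ = μ + (μ ^ 2 - 1) * geomSum (1 + μ) μ := by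
    rw [defect]
    linear_combination (-(μ : ℤ)) * hg
  -- The factor `n`, prime to `p`, clears the denominators of the binomial coefficients; `r` is the
  -- leading coefficient that must be a unit modulo `p`.
  have key : ∀ n r s : ℤ, IsCoprime (p : ℤ) n → n * defect (1 + μ) μ = μ ^ 2 * (r + p * s) →
      ¬(p : ℤ) ∣ r → ∃ e : ℤ, defect (1 + μ) μ = p ^ (2 * m) * e ∧ ¬(p : ℤ) ∣ e := by
    intro n r s hn he hr
    have e1 : n * defect (1 + μ) μ = p ^ (2 * m) * (u ^ 2 * (r + p * s)) := by
      rw [he, hμ]; ring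
    obtain ⟨e, hE'⟩ : (p : ℤ) ^ (2 * m) ∣ defect (1 + μ) μ :=
      (hn.pow_left).dvd_of_dvd_mul_left ⟨_, e1⟩
    refine ⟨e, hE', fun hd => hr ?_⟩
    rw [hE', mul_left_comm, mul_right_inj' (pow_ne_zero _ hpi.ne_zero)] at e1
    have h3 : (p : ℤ) ∣ u ^ 2 * (r + p * s) := e1 ▸ hd.mul_left _
    exact (dvd_add_left (dvd_mul_right _ _)).1
      ((hpi.dvd_or_dvd h3).resolve_left fun h => hu (hpi.dvd_of_dvd_pow h))
  obtain ⟨w, hw⟩ := hpμ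
  rcases hcase with h3 | ⟨rfl, ν, hν, hν'⟩
  · have hcop : ∀ n : ℕ, 0 < n → n < p → IsCoprime (p : ℤ) n := fun n h0 hn =>
      Nat.isCoprime_iff_coprime.2 (Nat.coprime_of_lt_prime h0.ne' hn hp)
    refine key (2 * 3) 3 (w * (3 - (μ - 1) * (μ - 2) - 6 * t + 3 * μ * (μ - 1) +
        μ ^ 2 * (μ - 1) * (μ - 2) + 6 * μ ^ 2 * t)) ?_ ?_ ?_
    · exact (hcop 2 (by norm_num) (by omega)).mul_right (hcop 3 (by norm_num) h3)
    · rw [hE, ht]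
      have : (μ : ℤ) ^ 2 * (3 + p * (w * (3 - (μ - 1) * (μ - 2) - 6 * t + 3 * μ * (μ - 1) +
        μ ^ 2 * (μ - 1) * (μ - 2) + 6 * μ ^ 2 * t))) = μ ^ 2 * (3 + μ * (3 - (μ - 1) * (μ - 2) - 6 * t + 3 * μ * (μ - 1) +
        μ ^ 2 * (μ - 1) * (μ - 2) + 6 * μ ^ 2 * t)) := by
        rw [← mul_assoc (p : ℤ), ← hw]
      rw [this]
      linear_combination 3 * μ * (μ ^ 2 - 1) * h2 + μ ^ 2 * (μ ^ 2 - 1) * h6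
    · intro hd
      have := (hcop 3 (by norm_num) h3).isUnit_of_dvd' dvd_rfl hd
      exact hpi.not_isUnit this
  · have h6' : 2 * (μ.choose 3 : ℤ) = ν * (μ - 1) * (μ - 2) := by
      have : (3 : ℤ) ≠ 0 := by norm_num
      apply mul_left_cancel₀ this
      linear_combination h6 + (μ - 1) * (μ - 2) * hν
    obtain ⟨Q, hQ⟩ : ∃ Q : ℤ, Q = (μ - 1) * (1 + ν * (μ - 2)) + 2 * μ * t := ⟨_, rfl⟩
    refine key 2 (1 + ν) (-ν + ν * (1 + μ * Q - ν * μ + 3 * ν - 2 * t)) ?_ ?_ hν'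
    · exact ⟨1, -1, by norm_num⟩
    · rw [hE, ht]
      have h7 : 1 + ν + 3 * (-ν + ν * (1 + μ * Q - ν * μ + 3 * ν - 2 * t)) =
          2 * μ + (μ ^ 2 - 1) * Q := by
        rw [mul_add, ← mul_assoc, ← hν, hQ]
        linear_combination μ * hν
      rw [Nat.cast_ofNat, h7, hQ]
      linear_combination μ * (μ ^ 2 - 1) * h2 + μ ^ 2 * (μ ^ 2 - 1) * h6'

end IsMacdonaldPair

theorem IsPGroup.exists_zpow_zpow_eq {T : Type*} [Group T] {p : ℕ} (hT : IsPGroup p T)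
    (hp : p.Prime) {n : ℤ} (hn : ¬(p : ℤ) ∣ n) (x : T) : ∃ s : ℤ, (x ^ n) ^ s = x := by
  obtain ⟨N, hN⟩ := hT x
  obtain ⟨r, s, hrs⟩ : IsCoprime ((p : ℤ) ^ N) n :=
    ((Prime.coprime_iff_not_dvd (Nat.prime_iff_prime_int.1 hp)).2 hn).pow_left
  refine ⟨s, ?_⟩
  have h1 : x ^ (r * (p : ℤ) ^ N) = 1 := by
    rw [mul_comm, zpow_mul, ← Nat.cast_pow, zpow_natCast, hN, one_zpow]
  rw [← zpow_mul, mul_comm, ← one_mul (x ^ _), ← h1, ← zpow_add, hrs, zpow_one]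

theorem IsPGroup.eq_one_of_zpow_eq_one {T : Type*} [Group T] {p : ℕ} (hT : IsPGroup p T)
    (hp : p.Prime) {n : ℤ} (hn : ¬(p : ℤ) ∣ n) {x : T} (hx : x ^ n = 1) : x = 1 := by
  obtain ⟨s, hs⟩ := hT.exists_zpow_zpow_eq hp hn x
  rw [← hs, hx, one_zpow]

theorem zpow_eq_one_of_dvd {T : Type*} [Group T] {x : T} {n : ℕ} (hx : x ^ n = 1) {i : ℤ}
    (hi : (n : ℤ) ∣ i) : x ^ i = 1 := by
  obtain ⟨k, rfl⟩ := hi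
  rw [zpow_mul, zpow_natCast, hx, one_zpow]

namespace IsMacdonaldPair

variable {T : Type*} [Group T] {a b : T}

/-- In a `p`-group the factor `(1 + μ) * e`, prime to `p`, can be cancelled from the exponent
supplied by `commute_zpow_defect`. -/
theorem commute_pow_of_defect_eq {p m : ℕ} (hT : IsPGroup p T) (hp : p.Prime) {μ : ℕ}
    (h : IsMacdonaldPair (1 + μ : ℤ) a b) (hpμ : (p : ℤ) ∣ μ) {e : ℤ}
    (he : defect (1 + μ) μ = p ^ (2 * m) * e) (hpe : ¬(p : ℤ) ∣ e) : Commute (a ^ p ^ (2 * m)) b := by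
  have hpi := Nat.prime_iff_prime_int.1 hp
  have h1 := h.commute_zpow_defect (k := 1) (μ := μ) (by ring)
  have hn : ¬(p : ℤ) ∣ (1 + μ) * e := fun hd =>
    (hpi.dvd_or_dvd hd).elim (fun hd => hpi.not_isUnit (isUnit_of_dvd_one
      ((dvd_add_left hpμ).1 hd))) hpe
  obtain ⟨s, hs⟩ := hT.exists_zpow_zpow_eq hp hn (a ^ p ^ (2 * m))
  rw [← hs]
  refine Commute.zpow_left ?_ s
  rw [he, mul_left_comm, zpow_mul, ← Nat.cast_pow, zpow_natCast] at h1
  exact h1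

theorem pow_eq_one_of_defect_eq {p m : ℕ} (hT : IsPGroup p T) (hp : p.Prime) {μ : ℕ}
    (h : IsMacdonaldPair (1 + μ : ℤ) a b) {u : ℤ} (hm : 0 < m) (hμ : (μ : ℤ) = p ^ m * u)
    (hu : ¬(p : ℤ) ∣ u) {e : ℤ} (he : defect (1 + μ) μ = p ^ (2 * m) * e) (hpe : ¬(p : ℤ) ∣ e) :
    (a ^ p ^ (2 * m)) ^ p ^ m = 1 := by
  have hpμ : (p : ℤ) ∣ μ := hμ ▸ (dvd_pow_self _ hm.ne').mul_right _
  have h1 := h.zpow_eq_one_of_commute (i := (p ^ (2 * m) : ℕ))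
    (by rw [zpow_natCast]; exact h.commute_pow_of_defect_eq hT hp hpμ he hpe)
  rw [add_sub_cancel_left, hμ, zpow_mul, zpow_natCast, zpow_mul, ← Nat.cast_pow, zpow_natCast] at h1
  exact hT.eq_one_of_zpow_eq_one hp hu h1

theorem macdonaldCore {p m : ℕ} (hT : IsPGroup p T) (hp : p.Prime) (hp2 : p ≠ 2) {μ : ℕ}
    (h : IsMacdonaldPair (1 + μ : ℤ) a b) (hab : Subgroup.closure {a, b} = ⊤) {u : ℤ} (hm : 0 < m)
    (hμ : (μ : ℤ) = p ^ m * u) (hu : ¬(p : ℤ) ∣ u)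
    {e : ℤ} (he : defect (1 + μ) μ = p ^ (2 * m) * e) (hpe : ¬(p : ℤ) ∣ e) :
    MacdonaldCore (p ^ m) (1 + μ) a b := by
  have hpμ : (p : ℤ) ∣ μ := hμ ▸ (dvd_pow_self _ hm.ne').mul_right _
  have h2 : (p ^ m) ^ 2 = p ^ (2 * m) := by rw [← pow_mul, mul_comm]
  have ha := h.pow_eq_one_of_defect_eq hT hp hm hμ hu he hpe
  have hb := h.swap.pow_eq_one_of_defect_eq hT hp hm hμ hu he hpe
  have hc := h.commute_pow_of_defect_eq hT hp hpμ he hpe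
  have hz : a ^ p ^ (2 * m) ∈ Subgroup.center T :=
    commute_of_closure_pair hab ((Commute.refl a).pow_left _) hc
  refine ⟨h, hab, (hp.odd_of_ne_two hp2).pow, ⟨u, by rw [hμ]; push_cast; rfl⟩, ?_, ?_, by rwa [h2]⟩
  · rw [pow_succ, pow_mul, h2, ha]
  · have h1 := h.zpow_defect_eq (k := 1) (μ := μ) (by ring)
    -- Since `1 + μ ≡ 1` modulo `p ^ m`, its powers disappear from exponents of elements killed by
    -- `p ^ m`. What remains of `zpow_defect_eq` is that the `e`-th powers of `a ^ p ^ (2 * m)` and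
    -- `b ^ p ^ (2 * m)` are inverse to each other.
    have hmod : ∀ {x : T} (n : ℕ), x ^ p ^ m = 1 → x ^ (e * (1 + μ : ℤ) ^ n) = x ^ e := by
      intro x n hx
      rw [← mul_inv_eq_one, ← zpow_neg, ← zpow_add]
      refine zpow_eq_one_of_dvd hx ?_
      have h3 := sub_one_dvd_pow_sub_one (1 + μ : ℤ) n
      rw [add_sub_cancel_left] at h3
      rw [← sub_eq_add_neg, ← mul_sub_one, Nat.cast_pow]
      exact ((Dvd.intro u hμ.symm).trans h3).mul_left _
    rw [he, mul_assoc, show -((1 + μ : ℤ) * (p ^ (2 * m) * e)) =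
      p ^ (2 * m) * -(e * (1 + μ) ^ 1) by ring, zpow_mul b, zpow_mul a, ← Nat.cast_pow, zpow_natCast,
      zpow_natCast, hmod _ hb, zpow_neg, hmod _ ha] at h1
    rw [h2]
    have h4 : Commute (a ^ p ^ (2 * m)) (b ^ p ^ (2 * m)) := hc.pow_right _
    refine hT.eq_one_of_zpow_eq_one hp hpe ?_
    rw [h4.mul_zpow, h1, mul_inv_cancel]

end IsMacdonaldPair

/-! ### Assembly for the Sylow subgroup. -/

/-- The exponent is replaced by a natural number in its class modulo `N`, so that `defect` can be
used with `k = 1`, without losing the valuation or the case hypothesis. -/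
theorem exists_modEq_case {p : ℕ} (hp : p.Prime) {α : ℤ} (hα : α ≠ 1) (hpα : (p : ℤ) ∣ α - 1)
    {m : ℕ} (hm : m = padicValInt p (α - 1)) (hcase : IsCaseOne p α) {N : ℕ} (hN : 0 < N) :
    p ≠ 2 ∧ 0 < m ∧ ∃ (μ : ℕ) (u : ℤ), (N : ℤ) ∣ 1 + μ - α ∧ (μ : ℤ) = p ^ m * u ∧ ¬(p : ℤ) ∣ u ∧
      (3 < p ∨ p = 3 ∧ ∃ ν : ℤ, (μ : ℤ) = 3 * ν ∧ ¬(3 : ℤ) ∣ 1 + ν) := by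
  have : Fact p.Prime := ⟨hp⟩
  have hα' : α - 1 ≠ 0 := sub_ne_zero.2 hα
  have hm0 : 0 < m := by
    have h1 := (padicValInt_dvd_iff (p := p) 1 (α - 1)).1 (by rwa [pow_one])
    omega
  obtain ⟨v, hv⟩ : (p : ℤ) ^ m ∣ α - 1 := hm ▸ padicValInt_dvd _
  have hpv : ¬(p : ℤ) ∣ v := by
    rintro ⟨w, rfl⟩
    have : (p : ℤ) ^ (m + 1) ∣ α - 1 := ⟨w, by rw [hv]; ring⟩
    rw [padicValInt_dvd_iff] at this
    omega
  -- The extra factor `p ^ (m + 1)` preserves the valuation `m` and, for `p = 3`, the residue of `(α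
  -- - 1) / 3` modulo `3`.
  have hM : 0 < N * p ^ (m + 1) := Nat.mul_pos hN (pow_pos hp.pos _)
  obtain ⟨μ, hμ⟩ := Int.eq_ofNat_of_zero_le
    (Int.emod_nonneg (α - 1) (b := ((N * p ^ (m + 1) : ℕ) : ℤ)) (by exact_mod_cast hM.ne'))
  have hμ' := Int.emod_add_mul_ediv (α - 1) ((N * p ^ (m + 1) : ℕ) : ℤ)
  obtain ⟨r, hr⟩ : ∃ r, r = (α - 1) / ((N * p ^ (m + 1) : ℕ) : ℤ) := ⟨_, rfl⟩
  rw [hμ, ← hr] at hμ'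
  push_cast at hμ'
  refine ⟨?_, hm0, μ, v - N * p * r, ⟨-(p ^ (m + 1) * r), by linear_combination hμ'⟩, ?_, ?_, ?_⟩
  · rintro rfl
    rcases hcase with h | h <;> omega
  · rw [mul_sub, ← hv]
    linear_combination hμ'
  · intro hd
    refine hpv ((dvd_sub_left (c := (N : ℤ) * p * r) ⟨N * r, by ring⟩).1 hd)
  · rcases hcase with h | ⟨rfl, h⟩
    · exact Or.inl h
    · refine Or.inr ⟨rfl, (α - 1) / 3 - N * 3 ^ m * r, ?_, ?_⟩
      · have h1 : (3 : ℤ) * ((α - 1) / 3) = α - 1 := Int.mul_ediv_cancel' hpα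
        push_cast at hμ'
        linear_combination hμ' - h1
      · have h3 : (3 : ℤ) ∣ N * 3 ^ m * r := ((dvd_pow_self 3 hm0.ne').mul_left _).mul_right _
        have h4 : (α - 1) / 3 % 3 = 0 ∨ (α - 1) / 3 % 3 = 1 := by
          refine h.imp (fun h1 => ?_) id
          rw [← hm] at h1
          obtain ⟨n, rfl⟩ := Nat.exists_eq_add_of_le' h1
          have h5 : α - 1 = 3 * (3 * (3 ^ n * v)) := by rw [hv]; push_cast; ring
          omega
        generalize (N : ℤ) * 3 ^ m * r = s at h3 ⊢
        omega

theorem exists_natCast_zpow_eq {T : Type*} [Group T] {x : T} {n : ℕ} (hn : 0 < n) (hx : x ^ n = 1)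
    (i : ℤ) : ∃ k : ℕ, (n : ℤ) ∣ i - k ∧ x ^ i = x ^ k := by
  obtain ⟨k, hk⟩ := Int.eq_ofNat_of_zero_le
    (Int.emod_nonneg i (b := (n : ℤ)) (by exact_mod_cast hn.ne'))
  have h1 : (n : ℤ) ∣ i - k := by
    rw [← hk]
    exact Int.dvd_self_sub_emod
  refine ⟨k, h1, ?_⟩
  rw [← zpow_natCast, ← mul_inv_eq_one, ← zpow_sub]
  exact zpow_eq_one_of_dvd hx h1

/-- Exponents are reduced modulo `q ^ 3` to natural numbers. The conditions on `i` and `j` already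
give `a ^ i * b ^ j = 1`, which leaves a trivial power of `c`. -/
theorem MacdonaldCore.indep_of_nat {T : Type*} [Group T] {q : ℕ} {α : ℕ} {a b : T}
    (h : MacdonaldCore q α a b)
    (h1 : ∀ i j k : ℕ, a ^ i * b ^ j * commR a b ^ k = 1 → q ^ 2 ∣ j ∧ i ≡ j [MOD q ^ 3])
    (h2 : ∀ k : ℕ, commR a b ^ k = 1 → q ^ 2 ∣ k) (i j k : ℤ)
    (hx : a ^ i * b ^ j * commR a b ^ k = 1) :
    (q : ℤ) ^ 2 ∣ j ∧ (q : ℤ) ^ 3 ∣ i - j ∧ (q : ℤ) ^ 2 ∣ k := by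
  have hq : 0 < q ^ 3 := pow_pos h.odd.pos 3
  have hc : commR a b ^ q ^ 3 = 1 := by rw [pow_succ, pow_mul, h.commR_pow, one_pow]
  obtain ⟨i', hi, ei⟩ := exists_natCast_zpow_eq hq h.left_pow i
  obtain ⟨j', hj, ej⟩ := exists_natCast_zpow_eq hq h.right_pow j
  obtain ⟨k', hk, ek⟩ := exists_natCast_zpow_eq hq hc k
  rw [ei, ej, ek] at hx
  push_cast at hi hj hk
  obtain ⟨h3, h4⟩ := h1 _ _ _ hx
  have h4' : (q : ℤ) ^ 3 ∣ i' - j' := by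
    rw [← Nat.cast_pow]
    exact (Nat.modEq_iff_dvd.1 h4.symm)
  have e1 : a ^ i' * b ^ j' = 1 := by
    obtain ⟨l, rfl⟩ := h3
    obtain ⟨s, hs⟩ := h4'
    rw [← zpow_natCast a, eq_add_of_sub_eq hs, zpow_add, h.zpow_pow, one_mul, zpow_natCast, pow_mul,
      pow_mul, h.right_eq, inv_pow, mul_inv_cancel]
  rw [e1, one_mul] at hx
  have h23 : (q : ℤ) ^ 2 ∣ q ^ 3 := pow_dvd_pow _ (by norm_num)
  refine ⟨?_, ?_, ?_⟩
  · have := dvd_add (h23.trans hj) (Int.natCast_dvd_natCast.2 h3)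
    rwa [sub_add_cancel] at this
  · have := dvd_add (dvd_sub hi hj) h4'
    rwa [show i - i' - (j - j') + ((i' : ℤ) - j') = i - j by ring] at this
  · have := dvd_add (h23.trans hk) (Int.natCast_dvd_natCast.2 (h2 _ hx))
    rwa [sub_add_cancel] at this

namespace MacdonaldGroup

theorem exists_macdonaldSylow {α : ℤ} (hα : α ≠ 1) {p : ℕ} (hp : p.Prime) (hpα : (p : ℤ) ∣ α - 1)
    {m : ℕ} (hm : m = padicValInt p (α - 1)) (hcase : IsCaseOne p α)
    (J : Sylow p (MacdonaldGroup α)) :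
    ∃ (β : ℤ) (a b : J), MacdonaldSylow (p ^ m) β a b := by
  have : Fact p.Prime := ⟨hp⟩
  have hp2 : p ≠ 2 := (exists_modEq_case hp hα hpα hm hcase one_pos).1
  -- The value `0` has no prime `p`, and `-1` allows only `p = 2`, which is excluded.
  have hα2 : 2 ≤ |α| := by
    by_contra! hlt
    obtain ⟨h1, h2⟩ := abs_lt.1 hlt
    have h3 : α = 0 ∨ α = -1 := by omega
    have h4 := hp.two_le
    rcases h3 with rfl | rfl
    · have := Int.le_of_dvd one_pos (dvd_neg.1 (by simpa using hpα))
      omega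
    · have := Int.le_of_dvd two_pos (dvd_neg.1 (by simpa using hpα) : (p : ℤ) ∣ 2)
      omega
  obtain ⟨_, _⟩ := isNilpotent_and_finite hα2
  obtain ⟨π, hπ, hker⟩ := Sylow.exists_projection J
  have hJ : IsPGroup p J := J.isPGroup'
  -- This modulus lets `1 + μ` replace `α` both in `J` and in the targets of exponent dividing `p ^
  -- (3 * m)`.
  obtain ⟨-, hm0, μ, u, ⟨s, hs⟩, hμ, hu, hcase'⟩ := exists_modEq_case hp hα hpα hm hcase
    (N := Nat.card J * p ^ (3 * m)) (Nat.mul_pos Nat.card_pos (pow_pos hp.pos _))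
  have hzpow : ∀ {H : Type} [Group H] {x : H} {n : ℕ}, x ^ n = 1 →
      n ∣ Nat.card J * p ^ (3 * m) → x ^ (1 + μ : ℤ) = x ^ α := by
    intro H _ x n hx hn
    rw [← mul_inv_eq_one, ← zpow_sub, hs]
    exact zpow_eq_one_of_dvd hx ((Int.natCast_dvd_natCast.2 hn).mul_right _)
  obtain ⟨a, ha⟩ : ∃ a, a = π (genA α) := ⟨_, rfl⟩
  obtain ⟨b, hb⟩ : ∃ b, b = π (genB α) := ⟨_, rfl⟩
  have hab : Subgroup.closure {a, b} = ⊤ := by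
    rw [ha, hb]
    exact closure_pair_map (closure_gen α) π hπ
  have hpair : IsMacdonaldPair (1 + μ : ℤ) a b := by
    have h1 := (isMacdonaldPair α).map π
    rw [← ha, ← hb] at h1
    exact h1.change_exponent (hzpow pow_card_eq_one' (dvd_mul_right _ _))
      (hzpow pow_card_eq_one' (dvd_mul_right _ _))
  obtain ⟨e, he, hpe⟩ := IsMacdonaldPair.exists_defect_eq hp hm0 hμ hu hcase'
  have hcore := hpair.macdonaldCore hJ hp hp2 hab hm0 hμ hu he hpe
  -- Any such pair in a `p`-group is the image of `(a, b)` under a homomorphism from `J`. It is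
  -- applied to the explicit model for `indep` and to the Heisenberg group.
  have hfactor : ∀ {H : Type} [Group H] {x y : H}, IsPGroup p H → IsMacdonaldPair (1 + μ : ℤ) x y →
      x ^ p ^ (3 * m) = 1 → y ^ p ^ (3 * m) = 1 → ∃ ρ : J →* H, ρ a = x ∧ ρ b = y := by
    intro H _ x y hH hxy hx hy
    have h1 : IsMacdonaldPair α x y := hxy.change_exponent
      (hzpow hx (dvd_mul_left _ _)).symm (hzpow hy (dvd_mul_left _ _)).symm
    refine ⟨π.liftOfSurjective hπ ⟨lift h1, hker hH _⟩, ?_, ?_⟩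
    · rw [ha]
      exact (π.liftOfRightInverse_comp_apply _ (Function.rightInverse_surjInv hπ) _ _).trans
        (lift_genA h1)
    · rw [hb]
      exact (π.liftOfRightInverse_comp_apply _ (Function.rightInverse_surjInv hπ) _ _).trans
        (lift_genB h1)
  have h1μ : (1 + μ : ℤ) = 1 + p ^ m * u := by rw [hμ]
  have hdvd : ∀ n k : ℕ, ((p ^ m : ℕ) : ℤ) ^ (n + 1) ∣ (1 + μ : ℤ) ^ k - 1 → (p ^ m) ^ n ∣ k := by
    intro n k hk
    rw [← pow_mul]
    refine pow_dvd_of_pow_dvd_pow_sub_one hp hp2 hm0 h1μ hu ?_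
    rwa [Nat.cast_pow, ← pow_mul, mul_add_one, add_comm] at hk
  have e2 : p ^ (2 * m) = (p ^ m) ^ 2 := by rw [← pow_mul, mul_comm]
  have e3 : p ^ (3 * m) = (p ^ m) ^ 3 := by rw [← pow_mul, mul_comm]
  have hαN : ((1 + μ : ℕ) : ℤ) = 1 + μ := by push_cast; rfl
  refine ⟨1 + μ, a, b, hcore, ?_, ?_, hdvd 2, ?_⟩
  · obtain ⟨H, _, x, y, hxy, hH, hx, hy, hind, hind'⟩ :=
      exists_macdonald_model hp hp2 hm0 (α := 1 + μ) (by omega) (hαN.trans h1μ)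
    rw [hαN] at hxy
    obtain ⟨ρ, rfl, rfl⟩ := hfactor hH hxy hx hy
    rw [← hαN] at hcore
    refine hcore.indep_of_nat (fun i j k hijk => ?_) (fun k hk => ?_)
    · rw [← e2, ← e3]
      refine hind i j k ?_
      rw [← map_commR, ← map_pow, ← map_pow, ← map_pow, ← map_mul, ← map_mul, hijk, map_one]
    · refine hdvd 2 k ?_
      have h1 := hind' k (by rw [← map_commR, ← map_pow, hk, map_one])
      rw [e3, ← Int.natCast_dvd_natCast, Nat.cast_sub (Nat.one_le_pow _ _ (by omega))] at h1
      push_cast at h1 ⊢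
      exact h1
  · intro k hk
    have := hdvd 1 k hk
    rwa [pow_one] at this
  · have hodd : Odd (p ^ m) := (hp.odd_of_ne_two hp2).pow
    have hH : IsPGroup p (Heis (ZMod (p ^ m))) := fun M => ⟨m, heis_pow_eq_one hodd M⟩
    have h3 : ∀ M : Heis (ZMod (p ^ m)), M ^ p ^ (3 * m) = 1 := fun M => by
      rw [e3, pow_succ', pow_mul, heis_pow_eq_one hodd, one_pow]
    exact hfactor hH (isMacdonaldPair_heisMk hodd (h1μ.trans (by push_cast; rfl))) (h3 _) (h3 _)

end MacdonaldGroup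

theorem proposition9p1 (α : ℤ) (hα : α ≠ 1) (p : ℕ) (hp : p.Prime) (hpα : (p : ℤ) ∣ α - 1)
    (m : ℕ) (hm : m = padicValInt p (α - 1)) (hcase : IsCaseOne p α)
    (J : Sylow p (MacdonaldGroup α)) :
    Subgroup.center J = powSubgroup J (p ^ (2 * m)) ∧
    Subgroup.upperCentralSeries J 3 = powSubgroup J (p ^ m) ∧
    (∀ x ∈ Subgroup.upperCentralSeries J 3, ∀ y ∈ Subgroup.upperCentralSeries J 3,
      x * y = y * x) ∧
    Nat.card (Subgroup.upperCentralSeries J 3) = p ^ (4 * m) ∧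
    Nonempty (Subgroup.upperCentralSeries J 3 ≃* PresentedGroup (zThreeRels p m)) ∧
    Nonempty (J ⧸ Subgroup.upperCentralSeries J 3 ≃* Heis (ZMod (p ^ m))) ∧
    Monoid.exponent J = p ^ (3 * m) := by
  obtain ⟨β, a, b, h⟩ := MacdonaldGroup.exists_macdonaldSylow hα hp hpα hm hcase J
  simp only [mul_comm _ m, pow_mul]
  exact ⟨h.center_eq, h.upperCentralSeries_three_eq, fun x hx y hy => (h.commute_of_mem_three hx hy).eq,
    h.card_three, h.nonempty_three_mulEquiv, h.nonempty_quotient_mulEquiv, h.exponent_eq⟩
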